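/- Let $g : \mathbb{R}^3 \to [0,\infty)$ with $g \in L^1 \cap L^\infty(\mathbb{R}^3)$ and $\int_{\mathbb{R}^3} g \, dx > 0$. Let $$\dot W^{1,2}(\mathbb{R}^3) := \{ h : \mathbb{R}^3 \to \mathbb{R} \;:\; h \in L^6(\mathbb{R}^3),\ \nabla h \in L^2(\mathbb{R}^3) \},$$ where $\nabla$ is the weak gradient and functions equal almost everywhere are identified. Let $\bar U \in \dot W^{1,2}(\mathbb{R}^3)$ be non-negative almost everywhere. Call $U \in \dot W^{1,2}(\mathbb{R}^3)$ a solution of $$\Delta U = \frac{g e^{\bar U + U}}{\int_{\mathbb{R}^3} g e^{\bar U + U} \, dx} \qquad (*)$$ if $g e^{\bar U + U} \in L^1(\mathbb{R}^3)$ (so that the right-hand side makes sense) and $$- \int_{\mathbb{R}^3} \nabla \chi \cdot \nabla U \, dx = \frac{\int_{\mathbb{R}^3} \chi \, g e^{\bar U + U} \, dx}{\int_{\mathbb{R}^3} g e^{\bar U + U} \, dx} \qquad \text{for all } \chi \in C_c^\infty(\mathbb{R}^3).$$ Then there exists a unique solution $\widehat U \in \dot W^{1,2}(\mathbb{R}^3)$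 of $(*)$, and for this $\widehat U$ $$0 < \int_{\mathbb{R}^3} g e^{\bar U + \widehat U} \, dx < +\infty .$$ -/

import Mathlib

open MeasureTheory
open scoped ContDiff ENNReal

/-- Three-dimensional Euclidean space, with Lebesgue measure `volume`. -/
abbrev R3 : Type := EuclideanSpace ℝ (Fin 3)

/-- `G` is the weak (distributional) gradient of `u` on `ℝ³`: both are locally integrable, and
`∫ u ∇χ = - ∫ χ G` (an identity between vectors of `ℝ³`) for all test functions `χ ∈ C_c^∞`. -/
def HasWeakGradient (u : R3 → ℝ) (G : R3 → R3) : Prop :=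
  LocallyIntegrable u volume ∧ LocallyIntegrable G volume ∧
    ∀ χ : R3 → ℝ, ContDiff ℝ ∞ χ → HasCompactSupport χ →
      ∫ x, u x • gradient χ x = - ∫ x, χ x • G x

/-- The homogeneous Sobolev space: `u ∈ L⁶(ℝ³)` with weak gradient in `L²(ℝ³)`. -/
def MemHomogeneousSobolev (u : R3 → ℝ) : Prop :=
  MemLp u 6 volume ∧ ∃ G : R3 → R3, HasWeakGradient u G ∧ MemLp G 2 volume

/-- `Δ u = F` in the weak sense, for a function `u` with weak gradient and a locally integrable
right-hand side `F`: `- ∫ ∇χ · ∇u = ∫ χ F` for all test functions `χ ∈ C_c^∞`. -/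
def IsWeakPoissonSolution (u F : R3 → ℝ) : Prop :=
  LocallyIntegrable F volume ∧ ∃ G : R3 → R3, HasWeakGradient u G ∧
    ∀ χ : R3 → ℝ, ContDiff ℝ ∞ χ → HasCompactSupport χ →
      - ∫ x, inner ℝ (gradient χ x) (G x) = ∫ x, χ x * F x

/-- `u` is a solution, in the homogeneous Sobolev space, of
`Δ u = g e^{V + u} / ∫ g e^{V + u}`. Integrability of `g e^{V + u}` is what makes the
right-hand side meaningful. -/
def IsFixedChargeSolution (g V u : R3 → ℝ) : Prop :=
  MemHomogeneousSobolev u ∧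
    Integrable (fun x => g x * Real.exp (V x + u x)) volume ∧
      IsWeakPoissonSolution u
        (fun x => g x * Real.exp (V x + u x) / ∫ y, g y * Real.exp (V y + u y))

/-! The equation is the Euler–Lagrange equation of `J(u) = ½ ∫ |∇u|² + log ∫ g e^{V + u}`
(`chargeEnergy`, with `V` the given potential), taken over the Sobolev functions for which `g e^{V +
u}` is integrable. The Dirichlet term is uniformly convex in `∇u`, and the logarithmic term is
convex by Hölder.

Existence is the direct method. Jensen bounds the logarithm below by an affine functional of `u`,
which the Sobolev inequality controls by `‖∇u‖₂` because `g ∈ L^{6/5}`; hence `J` is bounded below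
(`exists_le_chargeEnergy`). Uniform convexity (`IsAdmissible.midpoint`) makes the gradients of a
minimising sequence Cauchy in `L²`, and Sobolev makes the functions Cauchy in `L⁶`, so no weak
compactness is needed. Fatou shows that the limit is admissible and minimal (`exists_minimiser`).
Perturbing by a test function multiplies the density by a bounded factor, so the first variation
exists and gives the equation (`IsAdmissible.euler_lagrange`).

Uniqueness cannot simply test with the difference `w` of two solutions, since the right-hand sides
are only in `L¹`. The bounded function `arctan w` is used instead
(`IsSobolevPair.neg_integral_arctan_eq`). Both densities have mass one, so a constant may be
subtracted from `arctan w`; with the right constant, monotonicity of the exponential gives a sign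
that forces `∇w = 0`, and then `w = 0` by Sobolev.

Both halves rest on the density of test functions in `L⁶` with gradient in `L²`, obtained by cutoff
and mollification. -/

open Filter Topology ContinuousLinearMap

/-! ### Mollification in `L^p` -/

section Mollification

variable {E : Type*} [NormedAddCommGroup E] [NormedSpace ℝ E]

/-- Jensen's inequality for the convolution with a probability density. -/
theorem enorm_convolution_rpow_le {k : R3 → ℝ} (hk : Continuous k) (hk0 : ∀ x, 0 ≤ k x)
    (hk1 : ∫⁻ x, ENNReal.ofReal (k x) = 1) {f : R3 → E}
    (hf : StronglyMeasurable f) {p : ℝ} (hp : 1 ≤ p) (x : R3) :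
    ‖convolution k f (lsmul ℝ ℝ) volume x‖ₑ ^ p ≤
      ∫⁻ t, ENNReal.ofReal (k t) * ‖f (x - t)‖ₑ ^ p := by
  have hp0 : 0 < p := by linarith
  have hkm : Measurable fun x => ENNReal.ofReal (k x) := hk.measurable.ennreal_ofReal
  -- For the probability measure `k dt`, Jensen is the monotonicity of `L^p` norms in the exponent.
  let ν : Measure R3 := volume.withDensity fun x => ENNReal.ofReal (k x)
  have hν : IsProbabilityMeasure ν := ⟨by simp [ν, hk1]⟩
  have hsm : StronglyMeasurable fun t => f (x - t) :=
    hf.comp_measurable (measurable_const.sub measurable_id)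
  have h1 : ‖convolution k f (lsmul ℝ ℝ) volume x‖ₑ ≤ ∫⁻ t, ‖f (x - t)‖ₑ ∂ν := by
    rw [convolution_def]
    refine (enorm_integral_le_lintegral_enorm _).trans_eq ?_
    rw [lintegral_withDensity_eq_lintegral_mul _ hkm hsm.enorm]
    refine lintegral_congr fun t => ?_
    simp [enorm_smul, Real.enorm_of_nonneg (hk0 t)]
  have h2 := eLpNorm_le_eLpNorm_of_exponent_le (μ := ν) (f := fun t => f (x - t))
    (p := 1) (q := ENNReal.ofReal p) (by simpa using hp) hsm.aestronglyMeasurable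
  rw [eLpNorm_one_eq_lintegral_enorm, eLpNorm_eq_lintegral_rpow_enorm_toReal (by simpa using hp0)
    ENNReal.ofReal_ne_top, ENNReal.toReal_ofReal hp0.le] at h2
  calc _ ≤ (∫⁻ t, ‖f (x - t)‖ₑ ∂ν) ^ p := ENNReal.rpow_le_rpow h1 hp0.le
    _ ≤ ((∫⁻ t, ‖f (x - t)‖ₑ ^ p ∂ν) ^ (1 / p)) ^ p := ENNReal.rpow_le_rpow h2 hp0.le
    _ = ∫⁻ t, ‖f (x - t)‖ₑ ^ p ∂ν := by
      rw [← ENNReal.rpow_mul, one_div, inv_mul_cancel₀ hp0.ne', ENNReal.rpow_one]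
    _ = _ := by
      rw [lintegral_withDensity_eq_lintegral_mul _ hkm (hsm.enorm.pow_const p)]
      rfl

/-- Young's inequality for the convolution with a probability density. -/
theorem eLpNorm_convolution_le {k : R3 → ℝ} (hk : Continuous k) (hk0 : ∀ x, 0 ≤ k x)
    (hk1 : ∫⁻ x, ENNReal.ofReal (k x) = 1) {f : R3 → E} (hf : AEStronglyMeasurable f volume)
    {p : ℝ≥0∞} (hp : 1 ≤ p) (hp' : p ≠ ⊤) :
    eLpNorm (convolution k f (lsmul ℝ ℝ) volume) p volume ≤ eLpNorm f p volume := by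
  have hp0 : p ≠ 0 := (zero_lt_one.trans_le hp).ne'
  have hpr : 1 ≤ p.toReal := by
    rw [← ENNReal.toReal_one]; exact (ENNReal.toReal_le_toReal ENNReal.one_ne_top hp').2 hp
  have hcongr : convolution k f (lsmul ℝ ℝ) volume = convolution k (hf.mk f) (lsmul ℝ ℝ) volume :=
    convolution_congr _ (ae_eq_refl _) hf.ae_eq_mk
  rw [hcongr, eLpNorm_congr_ae hf.ae_eq_mk]
  have hm := hf.stronglyMeasurable_mk
  set h := hf.mk f
  have hkm : Measurable fun x => ENNReal.ofReal (k x) := hk.measurable.ennreal_ofReal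
  rw [eLpNorm_eq_lintegral_rpow_enorm_toReal hp0 hp', eLpNorm_eq_lintegral_rpow_enorm_toReal hp0 hp']
  refine ENNReal.rpow_le_rpow ?_ (by positivity)
  calc _ ≤ ∫⁻ x, ∫⁻ t, ENNReal.ofReal (k t) * ‖h (x - t)‖ₑ ^ p.toReal :=
        lintegral_mono fun x => enorm_convolution_rpow_le hk hk0 hk1 hm hpr x
    _ = ∫⁻ t, ∫⁻ x, ENNReal.ofReal (k t) * ‖h (x - t)‖ₑ ^ p.toReal := by
        refine lintegral_lintegral_swap (Measurable.aemeasurable ?_)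
        exact (hkm.comp measurable_snd).mul
          ((hm.comp_measurable (measurable_fst.sub measurable_snd)).enorm.pow_const _)
    _ = ∫⁻ t, ENNReal.ofReal (k t) * ∫⁻ x, ‖h x‖ₑ ^ p.toReal := by
        refine lintegral_congr fun t => ?_
        rw [lintegral_const_mul' _ _ ENNReal.ofReal_ne_top,
          lintegral_sub_right_eq_self (fun x => ‖h x‖ₑ ^ p.toReal) t]
    _ = _ := by rw [lintegral_mul_const _ hkm, hk1, one_mul]

theorem ContDiffBump.lintegral_normed (φ : ContDiffBump (0 : R3)) :
    ∫⁻ x, ENNReal.ofReal (φ.normed volume x) = 1 := by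
  rw [← ofReal_integral_eq_lintegral_ofReal φ.integrable_normed
    (.of_forall φ.nonneg_normed), φ.integral_normed, ENNReal.ofReal_one]

theorem ContDiffBump.eLpNorm_convolution_le (φ : ContDiffBump (0 : R3)) {f : R3 → E}
    (hf : AEStronglyMeasurable f volume) {p : ℝ≥0∞} (hp : 1 ≤ p) (hp' : p ≠ ⊤) :
    eLpNorm (convolution (φ.normed volume) f (lsmul ℝ ℝ) volume) p volume ≤
      eLpNorm f p volume :=
  _root_.eLpNorm_convolution_le φ.continuous_normed φ.nonneg_normed φ.lintegral_normed hf hp hp'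

/-- Uniform continuity gives uniform convergence, and once the mollifier radius is below `1` all the
differences vanish outside one fixed ball of finite volume. -/
theorem tendsto_eLpNorm_convolution_sub_of_continuous [CompleteSpace E]
    {φ : ℕ → ContDiffBump (0 : R3)}
    (hφ : Tendsto (fun i => (φ i).rOut) atTop (𝓝 0)) {f : R3 → E} (hf : Continuous f)
    (hfs : HasCompactSupport f) (p : ℝ≥0∞) :
    Tendsto (fun i => eLpNorm (convolution ((φ i).normed volume) f (lsmul ℝ ℝ) volume - f) p volume)
      atTop (𝓝 0) := by
  obtain ⟨R, hR⟩ := hfs.isCompact.isBounded.subset_closedBall (0 : R3)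
  have huc := hfs.uniformContinuous_of_continuous hf
  let B := Metric.closedBall (0 : R3) (R + 1)
  have hBt : volume B ^ (1 / p.toReal) ≠ ⊤ :=
    ENNReal.rpow_ne_top_of_nonneg (by simp) measure_closedBall_lt_top.ne
  have key : ∀ δ > 0, ∀ᶠ i in atTop,
      eLpNorm (convolution ((φ i).normed volume) f (lsmul ℝ ℝ) volume - f) p volume ≤
        ENNReal.ofReal δ * volume B ^ (1 / p.toReal) := by
    intro δ hδ
    obtain ⟨r, hr, hur⟩ := Metric.uniformContinuous_iff.1 huc δ hδ
    filter_upwards [hφ.eventually_lt_const (lt_min hr zero_lt_one)] with i hi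
    have hpt : ∀ x, ‖(convolution ((φ i).normed volume) f (lsmul ℝ ℝ) volume - f) x‖ ≤ δ := by
      intro x
      rw [Pi.sub_apply, ← dist_eq_norm]
      refine ContDiffBump.dist_normed_convolution_le hf.aestronglyMeasurable fun y hy => ?_
      exact (hur (lt_trans hy (hi.trans_le (min_le_left _ _)))).le
    have hout : ∀ x ∉ B, (convolution ((φ i).normed volume) f (lsmul ℝ ℝ) volume - f) x = 0 := by
      intro x hx
      have hxR : R + 1 < ‖x‖ := by simpa [B] using hx
      have hfz : ∀ y, R < ‖y‖ → f y = 0 := fun y hy => by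
        by_contra hne
        have := hR (subset_tsupport f hne)
        simp only [mem_closedBall_zero_iff] at this
        linarith
      have hfx : f x = 0 := hfz x (by linarith)
      rw [Pi.sub_apply, (φ i).normed_convolution_eq_right, sub_self]
      intro y hy
      rw [hfx]
      apply hfz
      have h1 : dist y x < 1 := lt_trans hy (hi.trans_le (min_le_right _ _))
      rw [dist_eq_norm, norm_sub_rev] at h1
      have := norm_sub_norm_le x y
      linarith
    have hind : (convolution ((φ i).normed volume) f (lsmul ℝ ℝ) volume - f) =
        B.indicator (convolution ((φ i).normed volume) f (lsmul ℝ ℝ) volume - f) := by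
      ext x
      by_cases hx : x ∈ B
      · rw [Set.indicator_of_mem hx]
      · rw [Set.indicator_of_notMem hx, hout x hx]
    rw [hind, eLpNorm_indicator_eq_eLpNorm_restrict measurableSet_closedBall]
    refine (eLpNorm_le_of_ae_bound (C := δ) (.of_forall hpt)).trans_eq ?_
    rw [Measure.restrict_apply_univ, one_div, mul_comm]
  rw [ENNReal.tendsto_nhds_zero]
  intro ε hε
  obtain ⟨δ, hδ, hδε⟩ : ∃ δ : ℝ, 0 < δ ∧ ENNReal.ofReal δ * volume B ^ (1 / p.toReal) ≤ ε := by
    have ht : Tendsto (fun δ : ℝ => ENNReal.ofReal δ * volume B ^ (1 / p.toReal)) (𝓝[>] 0) (𝓝 0) := by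
      have := ENNReal.Tendsto.mul_const (b := volume B ^ (1 / p.toReal))
        (ENNReal.tendsto_ofReal (tendsto_id (x := 𝓝 (0 : ℝ)))) (Or.inr hBt)
      simp only [id, ENNReal.ofReal_zero, zero_mul] at this
      exact this.mono_left nhdsWithin_le_nhds
    obtain ⟨δ, h1, h2⟩ := ((ht.eventually_le_const hε).and self_mem_nhdsWithin).exists
    exact ⟨δ, h2, h1⟩
  exact (key δ hδ).mono fun i hi => hi.trans hδε

/-- An `ε/3` argument: approximate by a continuous compactly supported function; Young's inequality
carries the approximation error through the convolution. -/
theorem tendsto_eLpNorm_convolution_sub [CompleteSpace E] {φ : ℕ → ContDiffBump (0 : R3)}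
    (hφ : Tendsto (fun i => (φ i).rOut) atTop (𝓝 0)) {f : R3 → E} {p : ℝ≥0∞} (hp : 1 ≤ p)
    (hp' : p ≠ ⊤) (hf : MemLp f p volume) :
    Tendsto (fun i => eLpNorm (convolution ((φ i).normed volume) f (lsmul ℝ ℝ) volume - f) p volume)
      atTop (𝓝 0) := by
  have hp0 : p ≠ 0 := (zero_lt_one.trans_le hp).ne'
  rw [ENNReal.tendsto_nhds_zero]
  intro ε hε
  have hε3 : ε / 3 ≠ 0 := (ENNReal.div_pos hε.ne' (by norm_num)).ne'
  obtain ⟨h, hhs, hhε, hhc, hhp⟩ := hf.exists_hasCompactSupport_eLpNorm_sub_le hp' hε3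
  have hlim := tendsto_eLpNorm_convolution_sub_of_continuous hφ hhc hhs p
  filter_upwards [(ENNReal.tendsto_nhds_zero.1 hlim) (ε / 3) (pos_iff_ne_zero.2 hε3)] with i hi
  set k := (φ i).normed (volume : Measure R3)
  have hke : ∀ {u : R3 → E}, LocallyIntegrable u volume →
      ConvolutionExists k u (lsmul ℝ ℝ) volume := fun hu =>
    (φ i).hasCompactSupport_normed.convolutionExists_left _ (φ i).continuous_normed hu
  have hmeas : ∀ {u : R3 → E}, LocallyIntegrable u volume →
      AEStronglyMeasurable (convolution k u (lsmul ℝ ℝ) volume) volume := fun hu =>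
    ((φ i).hasCompactSupport_normed.continuous_convolution_left _
      (φ i).continuous_normed hu).aestronglyMeasurable
  have hfl := hf.locallyIntegrable hp
  have hhl := hhp.locallyIntegrable hp
  have hsplit : convolution k f (lsmul ℝ ℝ) volume - f =
      convolution k (f - h) (lsmul ℝ ℝ) volume +
        ((convolution k h (lsmul ℝ ℝ) volume - h) + (h - f)) := by
    have : convolution k f (lsmul ℝ ℝ) volume = convolution k (f - h) (lsmul ℝ ℝ) volume +
        convolution k h (lsmul ℝ ℝ) volume := by
      rw [← ConvolutionExists.distrib_add (hke (hfl.sub hhl)) (hke hhl)]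
      simp
    rw [this]; abel
  rw [hsplit]
  have hm3 : AEStronglyMeasurable (h - f) volume := hhp.1.sub hf.1
  calc _ ≤ eLpNorm (convolution k (f - h) (lsmul ℝ ℝ) volume) p volume +
        (eLpNorm (convolution k h (lsmul ℝ ℝ) volume - h) p volume + eLpNorm (h - f) p volume) :=
        (eLpNorm_add_le (hmeas (hfl.sub hhl)) (((hmeas hhl).sub hhp.1).add hm3) hp).trans
          (add_le_add le_rfl (eLpNorm_add_le ((hmeas hhl).sub hhp.1) hm3 hp))
    _ ≤ ε / 3 + (ε / 3 + ε / 3) := by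
        gcongr
        · exact ((φ i).eLpNorm_convolution_le (hf.1.sub hhp.1) hp hp').trans hhε
        · rwa [eLpNorm_sub_comm]
    _ = ε := by rw [← add_assoc, ENNReal.add_thirds]

end Mollification

/-! ### Calculus of the gradient -/

section Gradient

theorem continuous_gradient {χ : R3 → ℝ} (hχ : ContDiff ℝ ∞ χ) : Continuous (gradient χ) :=
  (InnerProductSpace.toDual ℝ R3).symm.continuous.comp (hχ.continuous_fderiv (by simp))

theorem HasCompactSupport.gradient {χ : R3 → ℝ} (hχ : HasCompactSupport χ) :
    HasCompactSupport (gradient χ) :=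
  (hχ.fderiv ℝ).comp_left (map_zero (InnerProductSpace.toDual ℝ R3).symm)

theorem gradient_eq_of_inner {f : R3 → ℝ} {x v : R3} (h : ∀ y, fderiv ℝ f x y = inner ℝ v y) :
    gradient f x = v :=
  ext_inner_right ℝ fun y => by rw [inner_gradient_left, h]

theorem norm_gradient (f : R3 → ℝ) (x : R3) : ‖gradient f x‖ = ‖fderiv ℝ f x‖ :=
  (InnerProductSpace.toDual ℝ R3).symm.norm_map _

theorem gradient_mul {f h : R3 → ℝ} {x : R3} (hf : DifferentiableAt ℝ f x)
    (hh : DifferentiableAt ℝ h x) :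
    gradient (fun y => f y * h y) x = f x • gradient h x + h x • gradient f x :=
  gradient_eq_of_inner fun y => by
    rw [fderiv_fun_mul hf hh, inner_add_left, real_inner_smul_left, real_inner_smul_left,
      inner_gradient_left, inner_gradient_left]
    rfl

theorem gradient_sub_const {φ : R3 → ℝ} (hφ : Differentiable ℝ φ) (x t : R3) :
    gradient (fun s => φ (x - s)) t = - gradient φ (x - t) :=
  gradient_eq_of_inner fun y => by
    have h := (hφ (x - t)).hasFDerivAt.comp t ((hasFDerivAt_id t).const_sub x)
    have h' : fderiv ℝ (fun s => φ (x - s)) t = _ := h.fderiv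
    rw [h', inner_neg_left, inner_gradient_left]
    simp

end Gradient

/-! ### Sobolev pairs -/

/-- `u ∈ L⁶` has the weak gradient `G ∈ L²`. -/
structure IsSobolevPair (u : R3 → ℝ) (G : R3 → R3) : Prop where
  memLp : MemLp u 6 volume
  memLp_grad : MemLp G 2 volume
  test : ∀ χ : R3 → ℝ, ContDiff ℝ ∞ χ → HasCompactSupport χ →
    ∫ x, u x • gradient χ x = - ∫ x, χ x • G x

/-- Test functions separate locally integrable functions. This identifies the gradient in
`IsWeakPoissonSolution`, not assumed square integrable, with the `L²` gradient from
`MemHomogeneousSobolev`. -/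
theorem HasWeakGradient.ae_unique {u : R3 → ℝ} {G G' : R3 → R3} (h : HasWeakGradient u G)
    (h' : HasWeakGradient u G') : G =ᵐ[volume] G' :=
  ae_eq_of_integral_contDiff_smul_eq h.2.1 h'.2.1 fun χ hχ hs => by
    have := h.2.2 χ hχ hs
    rw [h'.2.2 χ hχ hs] at this
    exact (neg_injective this).symm

theorem integrable_smul_gradient {u : R3 → ℝ} (hu : LocallyIntegrable u volume) {χ : R3 → ℝ}
    (hχ : ContDiff ℝ ∞ χ) (hs : HasCompactSupport χ) :
    Integrable (fun x => u x • gradient χ x) volume :=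
  hu.integrable_smul_right_of_hasCompactSupport (continuous_gradient hχ) hs.gradient

theorem integrable_test_smul {G : R3 → R3} (hG : LocallyIntegrable G volume) {χ : R3 → ℝ}
    (hχ : ContDiff ℝ ∞ χ) (hs : HasCompactSupport χ) :
    Integrable (fun x => χ x • G x) volume :=
  hG.integrable_smul_left_of_hasCompactSupport hχ.continuous hs

/-- Integration by parts for smooth functions, one of them compactly supported. -/
theorem integral_smul_gradient {f χ : R3 → ℝ} (hf : ContDiff ℝ ∞ f) (hχ : ContDiff ℝ ∞ χ)
    (hs : HasCompactSupport χ) :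
    ∫ x, f x • gradient χ x = - ∫ x, χ x • gradient f x := by
  have hfl : LocallyIntegrable f volume := hf.continuous.locallyIntegrable
  have hgl : LocallyIntegrable (gradient f) volume := (continuous_gradient hf).locallyIntegrable
  have hi1 := integrable_smul_gradient hfl hχ hs
  have hi2 := integrable_test_smul hgl hχ hs
  refine ext_inner_left ℝ fun y => ?_
  rw [inner_neg_right, ← integral_inner hi1, ← integral_inner hi2]
  have h1 : ∀ x, inner ℝ y (f x • gradient χ x) = f x * fderiv ℝ χ x y := fun x => by
    rw [real_inner_smul_right, real_inner_comm, inner_gradient_left]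
  have h2 : ∀ x, inner ℝ y (χ x • gradient f x) = fderiv ℝ f x y * χ x := fun x => by
    rw [real_inner_smul_right, real_inner_comm, inner_gradient_left, mul_comm]
  simp_rw [h1, h2]
  refine integral_mul_fderiv_eq_neg_fderiv_mul_of_integrable ?_ ?_ ?_
    (fun x _ => hf.differentiable (by simp) x) (fun x _ => hχ.differentiable (by simp) x)
  · simpa only [h2] using hi2.const_inner (𝕜 := ℝ) y
  · simpa only [h1] using hi1.const_inner (𝕜 := ℝ) y
  · exact (hf.continuous.mul hχ.continuous).integrable_of_hasCompactSupport hs.mul_left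

namespace IsSobolevPair

variable {u v : R3 → ℝ} {G H : R3 → R3}

theorem locallyIntegrable (h : IsSobolevPair u G) : LocallyIntegrable u volume :=
  h.memLp.locallyIntegrable (by norm_num)

theorem locallyIntegrable_grad (h : IsSobolevPair u G) : LocallyIntegrable G volume :=
  h.memLp_grad.locallyIntegrable (by norm_num)

theorem hasWeakGradient (h : IsSobolevPair u G) : HasWeakGradient u G :=
  ⟨h.locallyIntegrable, h.locallyIntegrable_grad, h.test⟩

theorem add (h : IsSobolevPair u G) (h' : IsSobolevPair v H) :
    IsSobolevPair (u + v) (G + H) where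
  memLp := h.memLp.add h'.memLp
  memLp_grad := h.memLp_grad.add h'.memLp_grad
  test χ hχ hs := by
    simp only [Pi.add_apply, add_smul, smul_add]
    rw [integral_add (integrable_smul_gradient h.locallyIntegrable hχ hs)
      (integrable_smul_gradient h'.locallyIntegrable hχ hs),
      integral_add (integrable_test_smul h.locallyIntegrable_grad hχ hs)
      (integrable_test_smul h'.locallyIntegrable_grad hχ hs), h.test χ hχ hs, h'.test χ hχ hs,
      neg_add]

theorem const_smul (h : IsSobolevPair u G) (c : ℝ) : IsSobolevPair (c • u) (c • G) where
  memLp := h.memLp.const_smul c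
  memLp_grad := h.memLp_grad.const_smul c
  test χ hχ hs := by
    simp only [Pi.smul_apply, smul_assoc, smul_comm _ c]
    rw [integral_smul, integral_smul, h.test χ hχ hs, smul_neg]

theorem neg (h : IsSobolevPair u G) : IsSobolevPair (-u) (-G) := by
  simpa using h.const_smul (-1)

theorem sub (h : IsSobolevPair u G) (h' : IsSobolevPair v H) :
    IsSobolevPair (u - v) (G - H) := by
  simpa [sub_eq_add_neg] using h.add h'.neg

/-- Test functions are Sobolev functions. -/
theorem of_test {χ : R3 → ℝ} (hχ : ContDiff ℝ ∞ χ) (hs : HasCompactSupport χ) :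
    IsSobolevPair χ (gradient χ) where
  memLp := hχ.continuous.memLp_of_hasCompactSupport hs
  memLp_grad := (continuous_gradient hχ).memLp_of_hasCompactSupport hs.gradient
  test _ hψ hψs := integral_smul_gradient hχ hψ hψs

end IsSobolevPair

theorem MemHomogeneousSobolev.exists_pair {u : R3 → ℝ} (h : MemHomogeneousSobolev u) :
    ∃ G, IsSobolevPair u G := by
  obtain ⟨h6, G, hG, h2⟩ := h
  exact ⟨G, h6, h2, hG.2.2⟩

theorem IsSobolevPair.memHomogeneousSobolev {u : R3 → ℝ} {G : R3 → R3} (h : IsSobolevPair u G) :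
    MemHomogeneousSobolev u :=
  ⟨h.memLp, G, h.hasWeakGradient, h.memLp_grad⟩

/-! ### Limits of weak formulations, Leibniz rule, mollified gradients -/

/-- Multiplication by a fixed function of the dual `L^q` is continuous from `L^p` to `ℝ`, under
the integral sign. -/
theorem tendsto_integral_smul_left {E : Type*} [NormedAddCommGroup E] [NormedSpace ℝ E]
    {p q : ℝ≥0∞} [p.HolderConjugate q] {φ : R3 → ℝ} (hφ : MemLp φ p volume)
    {F : ℕ → R3 → E} {f : R3 → E} (hF : ∀ n, MemLp (F n) q volume) (hf : MemLp f q volume)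
    (h : Tendsto (fun n => eLpNorm (F n - f) q volume) atTop (𝓝 0)) :
    Tendsto (fun n => ∫ x, φ x • F n x) atTop (𝓝 (∫ x, φ x • f x)) := by
  refine tendsto_integral_of_L1' (fun x => φ x • f x) (hφ.1.smul hf.1)
    (.of_forall fun n => memLp_one_iff_integrable.1 ((hF n).smul hφ)) ?_
  have hlim : Tendsto (fun n => eLpNorm φ p volume * eLpNorm (F n - f) q volume) atTop (𝓝 0) := by
    simpa using ENNReal.Tendsto.const_mul h (Or.inr hφ.2.ne)
  refine tendsto_of_tendsto_of_tendsto_of_le_of_le tendsto_const_nhds hlim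
    (fun _ => zero_le) fun n => ?_
  have := eLpNorm_smul_le_mul_eLpNorm (p := p) (q := q) (r := 1) ((hF n).1.sub hf.1) hφ.1
  refine le_trans (le_of_eq ?_) this
  congr 1; ext x; simp [smul_sub]

theorem tendsto_integral_smul_right {E : Type*} [NormedAddCommGroup E] [NormedSpace ℝ E]
    {p q : ℝ≥0∞} [p.HolderConjugate q] {φ : R3 → E} (hφ : MemLp φ q volume)
    {F : ℕ → R3 → ℝ} {f : R3 → ℝ} (hF : ∀ n, MemLp (F n) p volume) (hf : MemLp f p volume)
    (h : Tendsto (fun n => eLpNorm (F n - f) p volume) atTop (𝓝 0)) :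
    Tendsto (fun n => ∫ x, F n x • φ x) atTop (𝓝 (∫ x, f x • φ x)) := by
  refine tendsto_integral_of_L1' (fun x => f x • φ x) (hf.1.smul hφ.1)
    (.of_forall fun n => memLp_one_iff_integrable.1 (hφ.smul (hF n))) ?_
  have hlim : Tendsto (fun n => eLpNorm (F n - f) p volume * eLpNorm φ q volume) atTop (𝓝 0) := by
    simpa using ENNReal.Tendsto.mul_const h (Or.inr hφ.2.ne)
  refine tendsto_of_tendsto_of_tendsto_of_le_of_le tendsto_const_nhds hlim
    (fun _ => zero_le) fun n => ?_
  have := eLpNorm_smul_le_mul_eLpNorm (p := p) (q := q) (r := 1) hφ.1 ((hF n).1.sub hf.1)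
  refine le_trans (le_of_eq ?_) this
  congr 1; ext x; simp [sub_smul]

/-- Sobolev pairs are closed under convergence in `L⁶ × L²`. -/
theorem IsSobolevPair.of_tendsto {U : ℕ → R3 → ℝ} {K : ℕ → R3 → R3} {u : R3 → ℝ} {G : R3 → R3}
    (h : ∀ n, IsSobolevPair (U n) (K n)) (hu : MemLp u 6 volume) (hG : MemLp G 2 volume)
    (hUu : Tendsto (fun n => eLpNorm (U n - u) 6 volume) atTop (𝓝 0))
    (hKG : Tendsto (fun n => eLpNorm (K n - G) 2 volume) atTop (𝓝 0)) :
    IsSobolevPair u G where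
  memLp := hu
  memLp_grad := hG
  test χ hχ hs := by
    have h6 : (1 : ℝ≥0∞) ≤ 6 := by norm_num
    have : ENNReal.HolderConjugate 6 (ENNReal.conjExponent 6) := .conjExponent h6
    have h1 := tendsto_integral_smul_right (p := 6) (q := ENNReal.conjExponent 6)
      ((continuous_gradient hχ).memLp_of_hasCompactSupport hs.gradient)
      (fun n => (h n).memLp) hu hUu
    have h2 := tendsto_integral_smul_left (p := 2) (q := 2)
      (hχ.continuous.memLp_of_hasCompactSupport hs) (fun n => (h n).memLp_grad) hG hKG
    refine tendsto_nhds_unique h1 ?_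
    simp_rw [fun n => (h n).test χ hχ hs]
    exact h2.neg

/-- The weak Leibniz rule for multiplication by a test function. -/
theorem HasWeakGradient.test_mul {u : R3 → ℝ} {G : R3 → R3} (h : HasWeakGradient u G) {η : R3 → ℝ}
    (hη : ContDiff ℝ ∞ η) {χ : R3 → ℝ} (hχ : ContDiff ℝ ∞ χ) (hs : HasCompactSupport χ) :
    ∫ x, (η x * u x) • gradient χ x = - ∫ x, χ x • (η x • G x + u x • gradient η x) := by
  have hprod : ContDiff ℝ ∞ fun x => η x * χ x := hη.mul hχ
  have hprods : HasCompactSupport fun x => η x * χ x := hs.mul_left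
  have hgr : ∀ x, gradient (fun y => η y * χ y) x = η x • gradient χ x + χ x • gradient η x :=
    fun x => gradient_mul (hη.differentiable (by simp) x) (hχ.differentiable (by simp) x)
  have key := h.2.2 _ hprod hprods
  have hc1 : HasCompactSupport (η • gradient χ) := hs.gradient.smul_left
  have hc2 : HasCompactSupport (χ • gradient η) := hs.smul_right
  have hi1 : Integrable (fun x => u x • (η x • gradient χ x)) volume :=
    h.1.integrable_smul_right_of_hasCompactSupport
      (hη.continuous.smul (continuous_gradient hχ)) hc1
  have hi2 : Integrable (fun x => u x • (χ x • gradient η x)) volume :=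
    h.1.integrable_smul_right_of_hasCompactSupport
      (hχ.continuous.smul (continuous_gradient hη)) hc2
  have hi3 : Integrable (fun x => (η x * χ x) • G x) volume := integrable_test_smul h.2.1 hprod hprods
  simp_rw [hgr, smul_add] at key
  rw [integral_add hi1 hi2] at key
  have e1 : ∀ x, (η x * u x) • gradient χ x = u x • (η x • gradient χ x) := fun x => by
    rw [smul_smul, mul_comm]
  have e2 : ∀ x, χ x • (η x • G x + u x • gradient η x) =
      (η x * χ x) • G x + u x • (χ x • gradient η x) := fun x => by
    rw [smul_add, smul_smul, mul_comm, smul_comm]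
  simp_rw [e1, e2]
  rw [integral_add hi3 hi2, eq_sub_of_add_eq key]
  abel

/-- Mollification commutes with the weak gradient. -/
theorem HasWeakGradient.gradient_convolution {u : R3 → ℝ} {G : R3 → R3} (h : HasWeakGradient u G)
    {φ : R3 → ℝ} (hφ : ContDiff ℝ ∞ φ) (hs : HasCompactSupport φ) :
    gradient (convolution φ u (lsmul ℝ ℝ) volume) = convolution φ G (lsmul ℝ ℝ) volume := by
  ext1 x
  refine gradient_eq_of_inner fun y => ?_
  have hd := hs.hasFDerivAt_convolution_left (lsmul ℝ ℝ) (μ := volume)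
    (hφ.of_le (by exact_mod_cast le_top)) h.1 x
  rw [hd.fderiv, convolution_eq_swap, convolution_eq_swap]
  have hex : ConvolutionExistsAt (fderiv ℝ φ) u x (precompL R3 (lsmul ℝ ℝ)) volume :=
    (hs.fderiv ℝ).convolutionExists_left _ (hφ.continuous_fderiv (by simp)) h.1 x
  have hint := hex.integrable_swap
  rw [ContinuousLinearMap.integral_apply hint]
  -- For fixed `x` the reflected mollifier `t ↦ φ (x - t)` is itself a test function; the weak
  -- gradient identity for it is the claim at `x`.
  have hφx : ContDiff ℝ ∞ fun t => φ (x - t) := hφ.comp (contDiff_const.sub contDiff_id)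
  have hsx : HasCompactSupport fun t => φ (x - t) :=
    hs.comp_homeomorph (Homeomorph.subLeft x)
  have key := h.2.2 _ hφx hsx
  have hi := integrable_smul_gradient h.1 hφx hsx
  simp_rw [gradient_sub_const (hφ.differentiable (by simp))] at key hi
  rw [real_inner_comm]
  have e : ∫ t, (lsmul ℝ ℝ) (φ (x - t)) (G t) = ∫ t, -(u t • - gradient φ (x - t)) := by
    rw [integral_neg, key, neg_neg]; rfl
  rw [e, ← integral_inner (f := fun t => -(u t • - gradient φ (x - t))) hi.neg]
  refine integral_congr_ae (.of_forall fun t => ?_)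
  simp only [smul_neg, neg_neg, real_inner_smul_right]
  rw [real_inner_comm, inner_gradient_left]
  simp [precompL_apply, mul_comm]

/-- Dominated convergence in `L^p` for multipliers with values in `[-1, 1]`. -/
theorem tendsto_eLpNorm_smul_of_tendsto_zero {E : Type*} [NormedAddCommGroup E] [NormedSpace ℝ E]
    {p : ℝ≥0∞} (hp0 : p ≠ 0) (hp' : p ≠ ⊤) {f : R3 → E} (hf : MemLp f p volume)
    {c : ℕ → R3 → ℝ} (hcm : ∀ n, Measurable (c n)) (hc1 : ∀ n x, ‖c n x‖ ≤ 1)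
    (hc : ∀ x, Tendsto (fun n => c n x) atTop (𝓝 0)) :
    Tendsto (fun n => eLpNorm (c n • f) p volume) atTop (𝓝 0) := by
  have hpr : 0 < p.toReal := ENNReal.toReal_pos hp0 hp'
  simp_rw [eLpNorm_eq_lintegral_rpow_enorm_toReal hp0 hp']
  have h1 : Tendsto (fun n => ∫⁻ x, ‖(c n • f) x‖ₑ ^ p.toReal) atTop (𝓝 (∫⁻ _ : R3, 0)) := by
    refine tendsto_lintegral_of_dominated_convergence' (fun x => ‖f x‖ₑ ^ p.toReal)
      (fun n => ((hcm n).aestronglyMeasurable.smul hf.1).enorm.pow_const _) (fun n => ?_) ?_ ?_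
    · refine .of_forall fun x => ENNReal.rpow_le_rpow ?_ hpr.le
      rw [Pi.smul_apply', enorm_smul]
      refine mul_le_of_le_one_left' ?_
      rw [← ofReal_norm, ENNReal.ofReal_le_one]
      exact hc1 n x
    · exact (lintegral_rpow_enorm_lt_top_of_eLpNorm_lt_top hp0 hp' hf.2).ne
    · refine .of_forall fun x => ?_
      have h2 : Tendsto (fun n => ‖(c n • f) x‖ₑ) atTop (𝓝 0) := by
        have : Tendsto (fun n => c n x • f x) atTop (𝓝 0) := by
          simpa using (hc x).smul_const (f x)
        simpa using this.enorm
      have := (ENNReal.continuous_rpow_const (y := p.toReal)).continuousAt.tendsto.comp h2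
      simpa [Function.comp_def, ENNReal.zero_rpow_of_pos hpr] using this
  have := (ENNReal.continuous_rpow_const (y := 1 / p.toReal)).continuousAt.tendsto.comp h1
  simpa [Function.comp_def, hpr] using this

/-! ### Cutoffs, density of test functions, Sobolev inequality -/

/-- A smooth function equal to `1` on the unit ball and vanishing outside the ball of radius `2`. -/
noncomputable def unitCutoff : ContDiffBump (0 : R3) := ⟨1, 2, by norm_num, by norm_num⟩

/-- The rescaled cutoff, equal to `1` on the ball of radius `n + 1`. -/
noncomputable def cutoff (n : ℕ) (x : R3) : ℝ := unitCutoff (((n : ℝ) + 1)⁻¹ • x)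

theorem contDiff_cutoff (n : ℕ) : ContDiff ℝ ∞ (cutoff n) :=
  unitCutoff.contDiff.comp (contDiff_const_smul _)

theorem cutoff_eq_one {n : ℕ} {x : R3} (hx : ‖x‖ ≤ n + 1) : cutoff n x = 1 := by
  have hn : (0 : ℝ) < n + 1 := by positivity
  refine unitCutoff.one_of_mem_closedBall ?_
  rw [mem_closedBall_zero_iff, norm_smul, norm_inv, Real.norm_of_nonneg hn.le]
  exact (inv_mul_le_one₀ hn).2 hx

theorem cutoff_nonneg (n : ℕ) (x : R3) : 0 ≤ cutoff n x := unitCutoff.nonneg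

theorem cutoff_le_one (n : ℕ) (x : R3) : cutoff n x ≤ 1 := unitCutoff.le_one

theorem cutoff_eq_zero {n : ℕ} {x : R3} (hx : 2 * ((n : ℝ) + 1) ≤ ‖x‖) : cutoff n x = 0 := by
  have hn : (0 : ℝ) < n + 1 := by positivity
  refine unitCutoff.zero_of_le_dist ?_
  rw [dist_zero_right, norm_smul, norm_inv, Real.norm_of_nonneg hn.le]
  rw [inv_mul_eq_div, le_div_iff₀ hn]
  exact hx

theorem hasCompactSupport_cutoff (n : ℕ) : HasCompactSupport (cutoff n) :=
  HasCompactSupport.intro (isCompact_closedBall 0 (2 * ((n : ℝ) + 1))) fun x hx =>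
    cutoff_eq_zero (by simpa using (not_le.1 fun h => hx (by simpa using h)).le)

theorem gradient_cutoff (n : ℕ) (x : R3) :
    gradient (cutoff n) x = ((n : ℝ) + 1)⁻¹ • gradient unitCutoff (((n : ℝ) + 1)⁻¹ • x) :=
  gradient_eq_of_inner fun y => by
    have hd : Differentiable ℝ unitCutoff := unitCutoff.contDiff.differentiable (n := 1) (by simp)
    have h := (hd (((n : ℝ) + 1)⁻¹ • x)).hasFDerivAt.comp x
      ((hasFDerivAt_id x).const_smul ((n : ℝ) + 1)⁻¹)
    have h' : fderiv ℝ (cutoff n) x = _ := h.fderiv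
    rw [h', real_inner_smul_left, inner_gradient_left]
    simp

theorem gradient_cutoff_eq_zero {n : ℕ} {x : R3} (hx : ‖x‖ < n + 1) :
    gradient (cutoff n) x = 0 := by
  have : cutoff n =ᶠ[𝓝 x] fun _ => 1 := by
    filter_upwards [(continuous_norm.tendsto x).eventually_lt_const hx] with y hy
    exact cutoff_eq_one hy.le
  rw [this.gradient_eq, gradient_fun_const]

theorem gradient_cutoff_eq_zero' {n : ℕ} {x : R3} (hx : 2 * ((n : ℝ) + 1) < ‖x‖) :
    gradient (cutoff n) x = 0 := by
  have : cutoff n =ᶠ[𝓝 x] fun _ => 0 := by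
    filter_upwards [(continuous_norm.tendsto x).eventually_const_lt hx] with y hy
    exact cutoff_eq_zero hy.le
  rw [this.gradient_eq, gradient_fun_const]

/-- The `L³` norm of the gradient of the cutoff is scale invariant, hence bounded. -/
theorem exists_eLpNorm_gradient_cutoff_le :
    ∃ K : ℝ≥0∞, K ≠ ⊤ ∧ ∀ n, eLpNorm (gradient (cutoff n)) 3 volume ≤ K := by
  have hsm : ContDiff ℝ ∞ (unitCutoff : R3 → ℝ) := unitCutoff.contDiff
  obtain ⟨M, hM⟩ := unitCutoff.hasCompactSupport.gradient.exists_bound_of_continuous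
    (continuous_gradient hsm)
  have hM0 : 0 ≤ M := (norm_nonneg _).trans (hM 0)
  refine ⟨ENNReal.ofReal (2 * M) * volume (Metric.closedBall (0 : R3) 1) ^ (3 : ℝ)⁻¹,
    ENNReal.mul_ne_top ENNReal.ofReal_ne_top
      (ENNReal.rpow_ne_top_of_nonneg (by norm_num) measure_closedBall_lt_top.ne), fun n => ?_⟩
  have hn : (0 : ℝ) < n + 1 := by positivity
  set B := Metric.closedBall (0 : R3) (2 * ((n : ℝ) + 1))
  have hind : gradient (cutoff n) = B.indicator (gradient (cutoff n)) := by
    ext1 x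
    by_cases hx : x ∈ B
    · rw [Set.indicator_of_mem hx]
    · rw [Set.indicator_of_notMem hx]
      exact gradient_cutoff_eq_zero' (by simpa [B] using hx)
  rw [hind, eLpNorm_indicator_eq_eLpNorm_restrict measurableSet_closedBall]
  have hb : ∀ x, ‖gradient (cutoff n) x‖ ≤ ((n : ℝ) + 1)⁻¹ * M := fun x => by
    rw [gradient_cutoff, norm_smul, norm_inv, Real.norm_of_nonneg hn.le]
    gcongr
    exact hM _
  -- The sup bound decays like `1/(n+1)`, while the cube root of the volume of the supporting ball
  -- grows like `n+1`: in dimension three the factors cancel exactly.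
  refine (eLpNorm_le_of_ae_bound (.of_forall hb)).trans_eq ?_
  rw [Measure.restrict_apply_univ, Measure.addHaar_closedBall' _ _ (by positivity),
    finrank_euclideanSpace_fin, ENNReal.mul_rpow_of_nonneg _ _ (by positivity),
    ENNReal.ofReal_rpow_of_nonneg (by positivity) (by positivity)]
  have e1 : ((2 * ((n : ℝ) + 1)) ^ 3) ^ ((3 : ℝ≥0∞).toReal⁻¹) = 2 * ((n : ℝ) + 1) := by
    have : ((3 : ℝ≥0∞).toReal⁻¹) = (((3 : ℕ) : ℝ))⁻¹ := by norm_num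
    rw [this, Real.pow_rpow_inv_natCast (by positivity) (by norm_num)]
  rw [e1, mul_right_comm, ← ENNReal.ofReal_mul (by positivity)]
  have e2 : 2 * ((n : ℝ) + 1) * (((n : ℝ) + 1)⁻¹ * M) = 2 * M := by field_simp
  rw [e2]
  norm_num

theorem holderTriple_six_three_two : ENNReal.HolderTriple 6 3 2 :=
  ENNReal.HolderTriple.of_toReal ⟨by norm_num, by norm_num, by norm_num⟩

namespace IsSobolevPair

variable {u : R3 → ℝ} {G : R3 → R3}

/-- Dominated convergence handles the factors `cutoff n - 1`. The commutator term `u ∇(cutoff n)` is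
bounded by Hölder with `1/6 + 1/3 = 1/2`: the `L³` norm of the cutoff gradient stays bounded, and it
only sees the `L⁶` tail of `u`. -/
theorem eLpNorm_mul_cutoff_sub_tendsto (h : IsSobolevPair u G) :
    Tendsto (fun n => eLpNorm ((fun x => cutoff n x * u x) - u) 6 volume) atTop (𝓝 0) ∧
    Tendsto (fun n => eLpNorm ((fun x => cutoff n x • G x + u x • gradient (cutoff n) x) - G)
      2 volume) atTop (𝓝 0) := by
  have hcm : ∀ n, Measurable fun x => cutoff n x - 1 := fun n =>
    (contDiff_cutoff n).continuous.measurable.sub_const 1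
  have hc1 : ∀ n x, ‖cutoff n x - 1‖ ≤ 1 := fun n x => by
    rw [Real.norm_eq_abs, abs_le]
    constructor <;> linarith [cutoff_nonneg n x, cutoff_le_one n x]
  have hlarge : ∀ x : R3, ∀ᶠ n : ℕ in atTop, ‖x‖ < n + 1 := fun x => by
    filter_upwards [eventually_ge_atTop ⌈‖x‖⌉₊] with n hn
    have := (Nat.le_ceil ‖x‖).trans (Nat.cast_le.2 hn)
    linarith
  have hc : ∀ x, Tendsto (fun n => cutoff n x - 1) atTop (𝓝 0) := fun x => by
    refine tendsto_const_nhds.congr' ?_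
    filter_upwards [hlarge x] with n hn
    rw [cutoff_eq_one hn.le, sub_self]
  constructor
  · refine (tendsto_eLpNorm_smul_of_tendsto_zero (by norm_num) (by norm_num) h.memLp hcm hc1
      hc).congr fun n => ?_
    congr 1; ext x; simp [sub_mul]
  · have t1 := tendsto_eLpNorm_smul_of_tendsto_zero (by norm_num) (by norm_num) h.memLp_grad
      hcm hc1 hc
    -- The cutoff gradient vanishes where `‖x‖ < n + 1`, so this indicator can be inserted at no
    -- cost; it turns the factor `u` into its tail.
    let d : ℕ → R3 → ℝ := fun n => {x : R3 | (n : ℝ) + 1 ≤ ‖x‖}.indicator 1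
    have hdm : ∀ n, Measurable (d n) := fun n =>
      measurable_one.indicator (measurableSet_le measurable_const measurable_norm)
    have t2 := tendsto_eLpNorm_smul_of_tendsto_zero (p := 6) (by norm_num) (by norm_num) h.memLp
      (c := d) hdm
      (fun n x => by
        by_cases hx : (n : ℝ) + 1 ≤ ‖x‖ <;> simp [d, hx])
      (fun x => by
        refine tendsto_const_nhds.congr' ?_
        filter_upwards [hlarge x] with n hn
        exact (Set.indicator_of_notMem (by simpa using hn) _).symm)
    obtain ⟨K, hK, hKn⟩ := exists_eLpNorm_gradient_cutoff_le
    have t3 : Tendsto (fun n => eLpNorm ((fun x => cutoff n x - 1) • G) 2 volume +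
        eLpNorm (d n • u) 6 volume * K) atTop (𝓝 0) := by
      simpa using t1.add (ENNReal.Tendsto.mul_const t2 (Or.inr hK))
    refine tendsto_of_tendsto_of_tendsto_of_le_of_le tendsto_const_nhds t3
      (fun _ => zero_le) fun n => ?_
    have hgm : AEStronglyMeasurable (gradient (cutoff n)) (volume : Measure R3) :=
      (continuous_gradient (contDiff_cutoff n)).aestronglyMeasurable
    have hdu : AEStronglyMeasurable (d n • u) (volume : Measure R3) :=
      (hdm n).aestronglyMeasurable.smul h.memLp.1
    have e : (fun x => cutoff n x • G x + u x • gradient (cutoff n) x) - G =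
        (fun x => cutoff n x - 1) • G + (d n • u) • gradient (cutoff n) := by
      ext1 x
      simp only [Pi.sub_apply, Pi.add_apply, Pi.smul_apply', sub_smul, one_smul]
      by_cases hx : (n : ℝ) + 1 ≤ ‖x‖
      · have : d n x = 1 := Set.indicator_of_mem (by simpa using hx) _
        rw [this, one_smul]; abel
      · rw [gradient_cutoff_eq_zero (not_le.1 hx), smul_zero, smul_zero]; abel
    rw [e]
    refine (eLpNorm_add_le ((hcm n).aestronglyMeasurable.smul h.memLp_grad.1) (hdu.smul hgm)
      (by norm_num)).trans (add_le_add le_rfl ?_)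
    have := holderTriple_six_three_two
    exact (eLpNorm_smul_le_mul_eLpNorm (p := 6) (q := 3) (r := 2) hgm hdu).trans (by gcongr; exact hKn n)

theorem mul_cutoff (h : IsSobolevPair u G) (n : ℕ) :
    IsSobolevPair (fun x => cutoff n x * u x)
      (fun x => cutoff n x • G x + u x • gradient (cutoff n) x) where
  memLp := h.memLp.mul (r := 6) ((contDiff_cutoff n).continuous.memLp_of_hasCompactSupport
    (p := ⊤) (hasCompactSupport_cutoff n))
  memLp_grad := by
    have := holderTriple_six_three_two
    exact (h.memLp_grad.smul (r := 2) ((contDiff_cutoff n).continuous.memLp_of_hasCompactSupport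
      (p := ⊤) (hasCompactSupport_cutoff n))).add
      (((continuous_gradient (contDiff_cutoff n)).memLp_of_hasCompactSupport (p := 3)
        (hasCompactSupport_cutoff n).gradient).smul (r := 2) h.memLp)
  test χ hχ hs := h.hasWeakGradient.test_mul (contDiff_cutoff n) hχ hs

/-- Mollification keeps the support compact and commutes with the weak gradient, so it converges in
both norms at once. -/
theorem exists_test_approx_of_hasCompactSupport (h : IsSobolevPair u G) (hu : HasCompactSupport u)
    {ε : ℝ≥0∞} (hε : ε ≠ 0) :
    ∃ χ : R3 → ℝ, ContDiff ℝ ∞ χ ∧ HasCompactSupport χ ∧ eLpNorm (χ - u) 6 volume ≤ ε ∧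
      eLpNorm (gradient χ - G) 2 volume ≤ ε := by
  let φ : ℕ → ContDiffBump (0 : R3) := fun n =>
    ⟨1 / ((n : ℝ) + 1) / 2, 1 / ((n : ℝ) + 1), by positivity, half_lt_self (by positivity)⟩
  have hφ : Tendsto (fun n => (φ n).rOut) atTop (𝓝 0) := tendsto_one_div_add_atTop_nhds_zero_nat
  have t1 := tendsto_eLpNorm_convolution_sub hφ (by norm_num) (by norm_num) h.memLp
  have t2 := tendsto_eLpNorm_convolution_sub hφ (by norm_num) (by norm_num) h.memLp_grad
  have hε' := pos_iff_ne_zero.2 hε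
  obtain ⟨n, h1, h2⟩ := ((ENNReal.tendsto_nhds_zero.1 t1 ε hε').and
    (ENNReal.tendsto_nhds_zero.1 t2 ε hε')).exists
  have hsm : ContDiff ℝ ∞ ((φ n).normed (volume : Measure R3)) := (φ n).contDiff_normed
  refine ⟨_, (φ n).hasCompactSupport_normed.contDiff_convolution_left (lsmul ℝ ℝ)
    hsm h.locallyIntegrable, (φ n).hasCompactSupport_normed.convolution _ hu, h1, ?_⟩
  rwa [h.hasWeakGradient.gradient_convolution hsm (φ n).hasCompactSupport_normed]

/-- Test functions are dense. -/
theorem exists_test_approx (h : IsSobolevPair u G) {ε : ℝ≥0∞} (hε : ε ≠ 0) :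
    ∃ χ : R3 → ℝ, ContDiff ℝ ∞ χ ∧ HasCompactSupport χ ∧ eLpNorm (χ - u) 6 volume ≤ ε ∧
      eLpNorm (gradient χ - G) 2 volume ≤ ε := by
  have hε2 := ENNReal.half_pos hε
  obtain ⟨t1, t2⟩ := h.eLpNorm_mul_cutoff_sub_tendsto
  obtain ⟨n, h1, h2⟩ := ((ENNReal.tendsto_nhds_zero.1 t1 _ hε2).and
    (ENNReal.tendsto_nhds_zero.1 t2 _ hε2)).exists
  have hn := h.mul_cutoff n
  obtain ⟨χ, hχ, hs, h3, h4⟩ := hn.exists_test_approx_of_hasCompactSupport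
    (hasCompactSupport_cutoff n).mul_right hε2.ne'
  have hp := of_test hχ hs
  refine ⟨χ, hχ, hs, ?_, ?_⟩
  · rw [← sub_add_sub_cancel χ (fun x => cutoff n x * u x) u]
    exact (eLpNorm_add_le (hp.memLp.1.sub hn.memLp.1) (hn.memLp.1.sub h.memLp.1)
      (by norm_num)).trans ((add_le_add h3 h1).trans_eq (ENNReal.add_halves ε))
  · rw [← sub_add_sub_cancel (gradient χ)
      (fun x => cutoff n x • G x + u x • gradient (cutoff n) x) G]
    exact (eLpNorm_add_le (hp.memLp_grad.1.sub hn.memLp_grad.1)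
      (hn.memLp_grad.1.sub h.memLp_grad.1)
      (by norm_num)).trans ((add_le_add h4 h2).trans_eq (ENNReal.add_halves ε))

theorem exists_test_tendsto (h : IsSobolevPair u G) :
    ∃ χ : ℕ → R3 → ℝ, (∀ n, ContDiff ℝ ∞ (χ n)) ∧ (∀ n, HasCompactSupport (χ n)) ∧
      Tendsto (fun n => eLpNorm (χ n - u) 6 volume) atTop (𝓝 0) ∧
      Tendsto (fun n => eLpNorm (gradient (χ n) - G) 2 volume) atTop (𝓝 0) := by
  choose χ h1 h2 h3 h4 using fun n : ℕ =>
    h.exists_test_approx (ε := ((n : ℝ≥0∞) + 1)⁻¹) (by simp)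
  have ht : Tendsto (fun n : ℕ => ((n : ℝ≥0∞) + 1)⁻¹) atTop (𝓝 0) := by
    have := (tendsto_add_atTop_iff_nat 1).2 ENNReal.tendsto_inv_nat_nhds_zero
    simpa using this
  exact ⟨χ, h1, h2,
    tendsto_of_tendsto_of_tendsto_of_le_of_le tendsto_const_nhds ht (fun _ => zero_le) h3,
    tendsto_of_tendsto_of_tendsto_of_le_of_le tendsto_const_nhds ht (fun _ => zero_le) h4⟩

/-- The Sobolev inequality `‖u‖₆ ≤ C ‖∇u‖₂`. -/
theorem exists_eLpNorm_le : ∃ C : NNReal, ∀ {u : R3 → ℝ} {G : R3 → R3}, IsSobolevPair u G →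
    eLpNorm u 6 volume ≤ C * eLpNorm G 2 volume := by
  let C := eLpNormLESNormFDerivOfEqInnerConst (volume : Measure R3) ((2 : NNReal) : ℝ)
  refine ⟨C, fun {u G} h => ?_⟩
  obtain ⟨χ, hχ, hs, t1, t2⟩ := h.exists_test_tendsto
  have hsob : ∀ n, eLpNorm (χ n) 6 volume ≤ C * eLpNorm (gradient (χ n)) 2 volume := fun n => by
    have := eLpNorm_le_eLpNorm_fderiv_of_eq_inner (volume : Measure R3) (p := 2) (p' := 6)
      ((hχ n).of_le (by exact_mod_cast le_top)) (hs n) (by norm_num) (by simp)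
      (by rw [finrank_euclideanSpace_fin]; norm_num)
    rw [eLpNorm_congr_norm_ae (g := fderiv ℝ (χ n)) (.of_forall (norm_gradient (χ n)))]
    exact this
  have hb : ∀ n, eLpNorm u 6 volume ≤ eLpNorm (χ n - u) 6 volume +
      C * (eLpNorm (gradient (χ n) - G) 2 volume + eLpNorm G 2 volume) := fun n => by
    have hp := of_test (hχ n) (hs n)
    calc _ = eLpNorm ((u - χ n) + χ n) 6 volume := by rw [sub_add_cancel]
      _ ≤ eLpNorm (u - χ n) 6 volume + eLpNorm (χ n) 6 volume :=
        eLpNorm_add_le (h.memLp.1.sub hp.memLp.1) hp.memLp.1 (by norm_num)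
      _ ≤ _ := by
        rw [eLpNorm_sub_comm]
        refine add_le_add le_rfl ((hsob n).trans ?_)
        gcongr
        calc _ = eLpNorm ((gradient (χ n) - G) + G) 2 volume := by rw [sub_add_cancel]
          _ ≤ _ := eLpNorm_add_le (hp.memLp_grad.1.sub h.memLp_grad.1) h.memLp_grad.1
            (by norm_num)
  have hlim : Tendsto (fun n => eLpNorm (χ n - u) 6 volume +
      C * (eLpNorm (gradient (χ n) - G) 2 volume + eLpNorm G 2 volume)) atTop
      (𝓝 (0 + C * (0 + eLpNorm G 2 volume))) :=
    t1.add (ENNReal.Tendsto.const_mul (t2.add tendsto_const_nhds)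
      (Or.inr ENNReal.coe_ne_top))
  simpa using ge_of_tendsto' hlim hb

end IsSobolevPair

/-! ### Testing with `arctan`, and uniqueness -/

theorem HasCompactSupport.arctan_comp {χ : R3 → ℝ} (hs : HasCompactSupport χ) :
    HasCompactSupport fun x => Real.arctan (χ x) :=
  hs.comp_left (g := Real.arctan) Real.arctan_zero

theorem gradient_arctan {χ : R3 → ℝ} (hχ : ContDiff ℝ ∞ χ) (x : R3) :
    gradient (fun y => Real.arctan (χ y)) x = (1 / (1 + χ x ^ 2)) • gradient χ x :=
  gradient_eq_of_inner fun y => by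
    have h := ((hχ.differentiable (by simp)) x).hasFDerivAt.arctan
    rw [h.fderiv, real_inner_smul_left, inner_gradient_left]
    rfl

theorem abs_arctan_le_two (t : ℝ) : |Real.arctan t| ≤ 2 := by
  rw [abs_le]
  constructor <;> linarith [Real.neg_pi_div_two_lt_arctan t, Real.arctan_lt_pi_div_two t,
    Real.pi_lt_four]

/-- In a Poisson equation with integrable right-hand side, `arctan w` is an admissible test
function. -/
theorem IsSobolevPair.neg_integral_arctan_eq {w : R3 → ℝ} {H : R3 → R3} (h : IsSobolevPair w H)
    {ρ : R3 → ℝ} (hρ : Integrable ρ volume)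
    (heq : ∀ χ : R3 → ℝ, ContDiff ℝ ∞ χ → HasCompactSupport χ →
      - ∫ x, inner ℝ (gradient χ x) (H x) = ∫ x, χ x * ρ x) :
    - ∫ x, 1 / (1 + w x ^ 2) * ‖H x‖ ^ 2 = ∫ x, Real.arctan (w x) * ρ x := by
  obtain ⟨χ, hχ, hs, t1, t2⟩ := h.exists_test_tendsto
  have hp := fun n => of_test (hχ n) (hs n)
  -- Norm convergence alone says nothing pointwise about `arctan (χ n)`; an almost everywhere
  -- convergent subsequence makes dominated convergence applicable.
  obtain ⟨ns, hns, hae⟩ := (tendstoInMeasure_of_tendsto_eLpNorm (by norm_num)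
    (fun n => (hp n).memLp.1) h.memLp.1 t1).exists_seq_tendsto_ae
  have t2' := t2.comp hns.tendsto_atTop
  set ψ : ℕ → R3 → ℝ := fun n => χ (ns n)
  have hψ : ∀ n, ContDiff ℝ ∞ (ψ n) := fun n => hχ _
  have hψs : ∀ n, HasCompactSupport (ψ n) := fun n => hs _
  have hψp : ∀ n, IsSobolevPair (ψ n) (gradient (ψ n)) := fun n => hp _
  have ha : ∀ t : ℝ, 0 ≤ 1 / (1 + t ^ 2) ∧ 1 / (1 + t ^ 2) ≤ 1 := fun t =>
    ⟨by positivity, (div_le_one (by positivity)).2 (by nlinarith [sq_nonneg t])⟩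
  have hac : Continuous fun t : ℝ => 1 / (1 + t ^ 2) :=
    continuous_const.div (by fun_prop) fun t => by positivity
  have hH2 : Integrable (fun x => ‖H x‖ ^ 2) volume := h.memLp_grad.integrable_norm_pow (by norm_num)
  have key : ∀ n, - ∫ x, inner ℝ ((1 / (1 + ψ n x ^ 2)) • gradient (ψ n) x) (H x) =
      ∫ x, Real.arctan (ψ n x) * ρ x := fun n => by
    have := heq (fun x => Real.arctan (ψ n x)) (Real.contDiff_arctan.comp (hψ n))
      (hψs n).arctan_comp
    simpa only [gradient_arctan (hψ n)] using this
  have hR : Tendsto (fun n => ∫ x, Real.arctan (ψ n x) * ρ x) atTop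
      (𝓝 (∫ x, Real.arctan (w x) * ρ x)) := by
    refine tendsto_integral_of_dominated_convergence (fun x => 2 * ‖ρ x‖) (fun n => ?_)
      (hρ.norm.const_mul 2) (fun n => .of_forall fun x => ?_) ?_
    · exact (Real.continuous_arctan.comp_aestronglyMeasurable (hψp n).memLp.1).mul hρ.1
    · rw [norm_mul]
      exact mul_le_mul_of_nonneg_right (abs_arctan_le_two _) (norm_nonneg _)
    · filter_upwards [hae] with x hx
      exact ((Real.continuous_arctan.tendsto _).comp hx).mul_const _
  have hL1 : Tendsto (fun n => ∫ x, 1 / (1 + ψ n x ^ 2) * ‖H x‖ ^ 2) atTop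
      (𝓝 (∫ x, 1 / (1 + w x ^ 2) * ‖H x‖ ^ 2)) := by
    refine tendsto_integral_of_dominated_convergence (fun x => ‖H x‖ ^ 2) (fun n => ?_)
      hH2 (fun n => .of_forall fun x => ?_) ?_
    · exact (hac.comp_aestronglyMeasurable (hψp n).memLp.1).mul hH2.1
    · rw [norm_mul, Real.norm_of_nonneg (ha _).1, Real.norm_of_nonneg (sq_nonneg _)]
      exact mul_le_of_le_one_left (sq_nonneg _) (ha _).2
    · filter_upwards [hae] with x hx
      exact ((hac.tendsto _).comp hx).mul_const _
  have hdiff : ∀ n, MemLp (gradient (ψ n) - H) 2 volume := fun n =>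
    (hψp n).memLp_grad.sub h.memLp_grad
  have hprod : ∀ n, Integrable (fun x => ‖(gradient (ψ n) - H) x‖ • ‖H x‖) volume := fun n =>
    memLp_one_iff_integrable.1 (h.memLp_grad.norm.smul (hdiff n).norm)
  have hE0 : Tendsto (fun n => ∫ x, ‖(gradient (ψ n) - H) x‖ • ‖H x‖) atTop (𝓝 0) := by
    have := tendsto_integral_smul_right (p := 2) (q := 2) h.memLp_grad.norm
      (F := fun n x => ‖(gradient (ψ n) - H) x‖) (f := 0) (fun n => (hdiff n).norm) MemLp.zero
      (by
        refine t2'.congr fun n => ?_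
        rw [sub_zero, eLpNorm_norm]
        rfl)
    simpa using this
  -- Write `∇ψ = (∇ψ - H) + H`: the first part vanishes in the limit by Cauchy–Schwarz, the second
  -- converges by dominated convergence.
  have hinn : ∀ n x, inner ℝ ((1 / (1 + ψ n x ^ 2)) • gradient (ψ n) x) (H x) =
      1 / (1 + ψ n x ^ 2) * inner ℝ ((gradient (ψ n) - H) x) (H x) +
        1 / (1 + ψ n x ^ 2) * ‖H x‖ ^ 2 := fun n x => by
    rw [real_inner_smul_left, Pi.sub_apply, inner_sub_left, real_inner_self_eq_norm_sq]; ring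
  have hbd : ∀ n x, ‖1 / (1 + ψ n x ^ 2) * inner ℝ ((gradient (ψ n) - H) x) (H x)‖ ≤
      ‖(gradient (ψ n) - H) x‖ • ‖H x‖ := fun n x => by
    rw [norm_mul, Real.norm_of_nonneg (ha _).1]
    exact (mul_le_of_le_one_left (norm_nonneg _) (ha _).2).trans (norm_inner_le_norm _ _)
  have hEi : ∀ n, Integrable
      (fun x => 1 / (1 + ψ n x ^ 2) * inner ℝ ((gradient (ψ n) - H) x) (H x)) volume := fun n =>
    (hprod n).mono' ((hac.comp_aestronglyMeasurable (hψp n).memLp.1).mul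
      ((hdiff n).1.inner h.memLp_grad.1)) (.of_forall (hbd n))
  have hMi : ∀ n, Integrable (fun x => 1 / (1 + ψ n x ^ 2) * ‖H x‖ ^ 2) volume := fun n =>
    hH2.mono' ((hac.comp_aestronglyMeasurable (hψp n).memLp.1).mul hH2.1) (.of_forall fun x => by
      rw [norm_mul, Real.norm_of_nonneg (ha _).1, Real.norm_of_nonneg (sq_nonneg _)]
      exact mul_le_of_le_one_left (sq_nonneg _) (ha _).2)
  have hE : Tendsto (fun n => ∫ x, 1 / (1 + ψ n x ^ 2) * inner ℝ ((gradient (ψ n) - H) x) (H x))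
      atTop (𝓝 0) :=
    squeeze_zero_norm (fun n => norm_integral_le_of_norm_le (hprod n) (.of_forall (hbd n))) hE0
  refine tendsto_nhds_unique ?_ hR
  simp_rw [← key, hinn, fun n => integral_add (hEi n) (hMi n)]
  simpa using (hE.add hL1).neg

/-- A Sobolev function with vanishing gradient vanishes. -/
theorem IsSobolevPair.ae_eq_zero {w : R3 → ℝ} {H : R3 → R3} (h : IsSobolevPair w H)
    (hH : H =ᵐ[volume] 0) : w =ᵐ[volume] 0 := by
  obtain ⟨C, hC⟩ := IsSobolevPair.exists_eLpNorm_le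
  have := hC h
  rw [eLpNorm_congr_ae hH, eLpNorm_zero, mul_zero, nonpos_iff_eq_zero] at this
  exact (eLpNorm_eq_zero_iff h.memLp.1 (by norm_num)).1 this

/-- A Poisson equation with monotone right-hand side has only the trivial solution. -/
theorem IsSobolevPair.ae_eq_zero_of_integral_arctan_nonneg {w : R3 → ℝ} {H : R3 → R3}
    (h : IsSobolevPair w H) {ρ : R3 → ℝ} (hρ : Integrable ρ volume)
    (heq : ∀ χ : R3 → ℝ, ContDiff ℝ ∞ χ → HasCompactSupport χ →
      - ∫ x, inner ℝ (gradient χ x) (H x) = ∫ x, χ x * ρ x)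
    (hpos : 0 ≤ ∫ x, Real.arctan (w x) * ρ x) : w =ᵐ[volume] 0 := by
  refine h.ae_eq_zero ?_
  have key := h.neg_integral_arctan_eq hρ heq
  have hH2 : Integrable (fun x => ‖H x‖ ^ 2) volume := h.memLp_grad.integrable_norm_pow (by norm_num)
  have hac : Continuous fun t : ℝ => 1 / (1 + t ^ 2) :=
    continuous_const.div (by fun_prop) fun t => by positivity
  have hnn : 0 ≤ fun x => 1 / (1 + w x ^ 2) * ‖H x‖ ^ 2 := fun x => by
    simp only [Pi.zero_apply]; positivity
  have hi : Integrable (fun x => 1 / (1 + w x ^ 2) * ‖H x‖ ^ 2) volume :=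
    hH2.mono' ((hac.comp_aestronglyMeasurable h.memLp.1).mul hH2.1) (.of_forall fun x => by
      rw [Real.norm_of_nonneg (hnn x)]
      exact mul_le_of_le_one_left (sq_nonneg _)
        ((div_le_one (by positivity)).2 (by nlinarith [sq_nonneg (w x)])))
  -- By `key`, the negative of this nonnegative integral is nonnegative; the weight is positive, so
  -- `H` vanishes almost everywhere.
  have hz : ∫ x, 1 / (1 + w x ^ 2) * ‖H x‖ ^ 2 = 0 :=
    le_antisymm (by linarith) (integral_nonneg hnn)
  filter_upwards [(integral_eq_zero_iff_of_nonneg hnn hi).1 hz] with x hx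
  have h1 : 1 + w x ^ 2 ≠ 0 := by positivity
  simpa [h1] using hx

theorem integrable_inner_of_memLp {G H : R3 → R3} (hG : MemLp G 2 volume)
    (hH : MemLp H 2 volume) : Integrable (fun x => inner ℝ (G x) (H x)) volume := by
  have hi : Integrable (fun x => ‖G x‖ • ‖H x‖) volume :=
    memLp_one_iff_integrable.1 (hH.norm.smul hG.norm)
  exact hi.mono' (hG.1.inner hH.1) (.of_forall fun x => norm_inner_le_norm _ _)

theorem integrable_test_mul {ρ : R3 → ℝ} (hρ : Integrable ρ volume) {χ : R3 → ℝ}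
    (hχ : ContDiff ℝ ∞ χ) (hs : HasCompactSupport χ) :
    Integrable (fun x => χ x * ρ x) volume :=
  hρ.locallyIntegrable.integrable_smul_left_of_hasCompactSupport hχ.continuous hs

theorem IsFixedChargeSolution.exists_pair {g V u : R3 → ℝ} (h : IsFixedChargeSolution g V u) :
    ∃ G, IsSobolevPair u G ∧ ∀ χ : R3 → ℝ, ContDiff ℝ ∞ χ → HasCompactSupport χ →
      - ∫ x, inner ℝ (gradient χ x) (G x) =
        ∫ x, χ x * (g x * Real.exp (V x + u x) / ∫ y, g y * Real.exp (V y + u y)) := by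
  obtain ⟨hu, -, -, G', hG', heq⟩ := h
  obtain ⟨G, hG⟩ := hu.exists_pair
  refine ⟨G, hG, fun χ hχ hs => ?_⟩
  rw [← heq χ hχ hs]
  congr 1
  refine integral_congr_ae ?_
  filter_upwards [hG.hasWeakGradient.ae_unique hG'] with x hx
  rw [hx]

/-- The exponential never vanishes, so the integrand has the same support as `g`. This legitimises
every logarithm and every division by a partition function below. -/
theorem integral_mul_exp_pos {g f : R3 → ℝ} (hg : Integrable g volume)
    (hg0 : ∀ᵐ x ∂(volume : Measure R3), 0 ≤ g x) (hg_pos : 0 < ∫ x, g x)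
    (hf : Integrable (fun x => g x * Real.exp (f x)) volume) :
    0 < ∫ x, g x * Real.exp (f x) := by
  rw [integral_pos_iff_support_of_nonneg_ae hg0 hg] at hg_pos
  rw [integral_pos_iff_support_of_nonneg_ae
    (hg0.mono fun x hx => mul_nonneg hx (Real.exp_pos _).le) hf]
  convert hg_pos using 2
  ext x
  simp [Real.exp_ne_zero]

/-- After normalisation the densities are `g e^V e^{u - log Zu}` and `g e^V e^{w - log Zw}`, so
their difference has the sign of `(u - w) - (log Zu - log Zw)`, not that of `u - w`. Equality of the
masses absorbs this shift. -/
theorem IsFixedChargeSolution.ae_unique {g V u w : R3 → ℝ} (hg : Integrable g volume)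
    (hg0 : ∀ᵐ x ∂(volume : Measure R3), 0 ≤ g x) (hg_pos : 0 < ∫ x, g x)
    (hu : IsFixedChargeSolution g V u) (hw : IsFixedChargeSolution g V w) :
    ∀ᵐ x ∂(volume : Measure R3), w x = u x := by
  obtain ⟨G, hG, hGeq⟩ := hu.exists_pair
  obtain ⟨H, hH, hHeq⟩ := hw.exists_pair
  have hui := hu.2.1
  have hwi := hw.2.1
  have hZu := integral_mul_exp_pos hg hg0 hg_pos hui
  have hZw := integral_mul_exp_pos hg hg0 hg_pos hwi
  set Zu := ∫ x, g x * Real.exp (V x + u x)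
  set Zw := ∫ x, g x * Real.exp (V x + w x)
  set ρu : R3 → ℝ := fun x => g x * Real.exp (V x + u x) / Zu
  set ρw : R3 → ℝ := fun x => g x * Real.exp (V x + w x) / Zw
  have hρu : Integrable ρu volume := hui.div_const _
  have hρw : Integrable ρw volume := hwi.div_const _
  have hIu : ∫ x, ρu x = 1 := by rw [integral_div, div_self hZu.ne']
  have hIw : ∫ x, ρw x = 1 := by rw [integral_div, div_self hZw.ne']
  have hρ : Integrable (ρu - ρw) volume := hρu.sub hρw
  have hpair := hG.sub hH
  have heq : ∀ χ : R3 → ℝ, ContDiff ℝ ∞ χ → HasCompactSupport χ →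
      - ∫ x, inner ℝ (gradient χ x) ((G - H) x) = ∫ x, χ x * (ρu - ρw) x := by
    intro χ hχ hs
    have hg2 : MemLp (gradient χ) 2 volume := (IsSobolevPair.of_test hχ hs).memLp_grad
    have hiG : Integrable (fun x => inner ℝ (gradient χ x) (G x)) volume :=
      integrable_inner_of_memLp hg2 hG.memLp_grad
    have hiH : Integrable (fun x => inner ℝ (gradient χ x) (H x)) volume :=
      integrable_inner_of_memLp hg2 hH.memLp_grad
    have hiu : Integrable (fun x => χ x * ρu x) volume :=
      integrable_test_mul hρu hχ hs
    have hiw : Integrable (fun x => χ x * ρw x) volume :=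
      integrable_test_mul hρw hχ hs
    simp only [Pi.sub_apply, inner_sub_right, mul_sub]
    rw [integral_sub hiG hiH, integral_sub hiu hiw, ← hGeq χ hχ hs, ← hHeq χ hχ hs]
    ring
  have hai : Integrable (fun x => Real.arctan ((u - w) x) * (ρu - ρw) x) volume :=
    hρ.bdd_mul (c := 2) (Real.continuous_arctan.comp_aestronglyMeasurable hpair.memLp.1)
      (.of_forall fun x => abs_arctan_le_two _)
  -- The value of `arctan (u - w)` at the level where the two densities cross.
  set c := Real.arctan (Real.log Zu - Real.log Zw)
  have hpos : 0 ≤ ∫ x, Real.arctan ((u - w) x) * (ρu - ρw) x := by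
    have hshift : ∫ x, Real.arctan ((u - w) x) * (ρu - ρw) x =
        ∫ x, (Real.arctan ((u - w) x) * (ρu - ρw) x - c * (ρu - ρw) x) := by
      rw [integral_sub hai (hρ.const_mul c), integral_const_mul]
      simp only [Pi.sub_apply]
      rw [integral_sub hρu hρw, hIu, hIw]
      simp
    rw [hshift]
    refine integral_nonneg_of_ae ?_
    filter_upwards [hg0] with x hx
    simp only [Pi.zero_apply, Pi.sub_apply]
    rw [← sub_mul]
    have e : ρu x - ρw x = g x * Real.exp (V x) *
        (Real.exp (u x - Real.log Zu) - Real.exp (w x - Real.log Zw)) := by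
      simp only [ρu, ρw]
      rw [Real.exp_add, Real.exp_add, Real.exp_sub, Real.exp_sub, Real.exp_log hZu,
        Real.exp_log hZw]
      ring
    rw [e]
    have hgx : 0 ≤ g x * Real.exp (V x) := mul_nonneg hx (Real.exp_pos _).le
    rcases le_total (u x - Real.log Zu) (w x - Real.log Zw) with hle | hle
    · have h1 : Real.arctan (u x - w x) ≤ c := Real.arctan_strictMono.monotone (by linarith)
      have h2 := Real.exp_le_exp.2 hle
      exact mul_nonneg_of_nonpos_of_nonpos (by linarith)
        (mul_nonpos_of_nonneg_of_nonpos hgx (by linarith))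
    · have h1 : c ≤ Real.arctan (u x - w x) := Real.arctan_strictMono.monotone (by linarith)
      have h2 := Real.exp_le_exp.2 hle
      exact mul_nonneg (by linarith) (mul_nonneg hgx (by linarith))
  filter_upwards [hpair.ae_eq_zero_of_integral_arctan_nonneg hρ heq hpos] with x hx
  exact (sub_eq_zero.1 hx).symm

/-! ### Bounds for the linear functional given by `g` -/

/-- Interpolation: `|g|^q ≤ ‖g‖_∞^{q-1} |g|` almost everywhere. -/
theorem memLp_of_memLp_one_of_memLp_top {g : R3 → ℝ} (h1 : MemLp g 1 volume)
    (ht : MemLp g ⊤ volume) {q : ℝ≥0∞} (hq : 1 ≤ q) (hq' : q ≠ ⊤) : MemLp g q volume := by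
  have hq0 : q ≠ 0 := (zero_lt_one.trans_le hq).ne'
  have hqr : 1 ≤ q.toReal := by
    rw [← ENNReal.toReal_one]; exact (ENNReal.toReal_le_toReal ENNReal.one_ne_top hq').2 hq
  refine ⟨h1.1, (eLpNorm_lt_top_iff_lintegral_rpow_enorm_lt_top hq0 hq').2 ?_⟩
  set K := eLpNormEssSup g volume
  have hK : K < ⊤ := by simpa [eLpNorm_exponent_top] using ht.2
  calc ∫⁻ x, ‖g x‖ₑ ^ q.toReal ≤ ∫⁻ x, K ^ (q.toReal - 1) * ‖g x‖ₑ := by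
        refine lintegral_mono_ae ?_
        filter_upwards [ae_le_eLpNormEssSup (f := g)] with x hx
        have : ‖g x‖ₑ ^ q.toReal = ‖g x‖ₑ ^ (q.toReal - 1) * ‖g x‖ₑ := by
          conv_rhs => rw [← ENNReal.rpow_one ‖g x‖ₑ, ← ENNReal.rpow_mul, one_mul]
          rw [← ENNReal.rpow_add_of_nonneg _ _ (by linarith) zero_le_one, sub_add_cancel]
        rw [this]
        gcongr
    _ = K ^ (q.toReal - 1) * ∫⁻ x, ‖g x‖ₑ := lintegral_const_mul'' _ h1.1.enorm
    _ < ⊤ := ENNReal.mul_lt_top (ENNReal.rpow_lt_top_of_nonneg (by linarith) hK.ne)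
        (by simpa [eLpNorm_one_eq_lintegral_enorm] using h1.2)

theorem eLpNorm_two_eq {G : R3 → R3} (hG : MemLp G 2 volume) :
    eLpNorm G 2 volume = ENNReal.ofReal (√(∫ x, ‖G x‖ ^ 2)) := by
  rw [hG.eLpNorm_eq_integral_rpow_norm (by norm_num) (by norm_num), Real.sqrt_eq_rpow]
  norm_num

theorem tendsto_integral_norm_sq {K : ℕ → R3 → R3} {G : R3 → R3} (hK : ∀ n, MemLp (K n) 2 volume)
    (hG : MemLp G 2 volume) (h : Tendsto (fun n => eLpNorm (K n - G) 2 volume) atTop (𝓝 0)) :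
    Tendsto (fun n => ∫ x, ‖K n x‖ ^ 2) atTop (𝓝 (∫ x, ‖G x‖ ^ 2)) := by
  have e : ∀ {F : R3 → R3} (hF : MemLp F 2 volume), ‖hF.toLp F‖ ^ 2 = ∫ x, ‖F x‖ ^ 2 := by
    intro F hF
    rw [Lp.norm_toLp, eLpNorm_two_eq hF, ENNReal.toReal_ofReal (Real.sqrt_nonneg _),
      Real.sq_sqrt (integral_nonneg fun x => sq_nonneg _)]
  have := (((Lp.tendsto_Lp_iff_tendsto_eLpNorm'' K hK G hG).2 h).norm).pow 2
  simpa only [e] using this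

/-- Hölder's inequality and the Sobolev inequality for the linear functional `u ↦ ∫ g u`. -/
theorem exists_abs_integral_mul_le {g : R3 → ℝ} (h1 : MemLp g 1 volume) (ht : MemLp g ⊤ volume) :
    ∃ N : ℝ, 0 ≤ N ∧ ∀ {u : R3 → ℝ} {G : R3 → R3}, IsSobolevPair u G →
      Integrable (fun x => g x * u x) volume ∧ |∫ x, g x * u x| ≤ N * √(∫ x, ‖G x‖ ^ 2) := by
  obtain ⟨C, hC⟩ := IsSobolevPair.exists_eLpNorm_le
  -- This is `6/5`.
  let q := ENNReal.conjExponent 6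
  have : ENNReal.HolderConjugate 6 q := .conjExponent (by norm_num)
  have hq1 : 1 ≤ q := ENNReal.HolderConjugate.one_le q 6
  have hqt : q ≠ ⊤ := by
    have : (6 : ℝ≥0∞) - 1 ≠ 0 := (tsub_pos_of_lt (by norm_num)).ne'
    simp [q, ENNReal.conjExponent, this]
  have hgq := memLp_of_memLp_one_of_memLp_top h1 ht hq1 hqt
  refine ⟨(eLpNorm g q volume).toReal * C, by positivity, fun {u G} h => ?_⟩
  have hi : Integrable (fun x => g x * u x) volume :=
    memLp_one_iff_integrable.1 (h.memLp.smul (p := q) (q := 6) hgq)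
  refine ⟨hi, ?_⟩
  have hb : eLpNorm (fun x => g x * u x) 1 volume ≤
      eLpNorm g q volume * (C * ENNReal.ofReal √(∫ x, ‖G x‖ ^ 2)) :=
    (eLpNorm_smul_le_mul_eLpNorm (p := q) (q := 6) (r := 1) h.memLp.1 hgq.1).trans (by
      gcongr
      rw [← eLpNorm_two_eq h.memLp_grad]
      exact hC h)
  have h2 : |∫ x, g x * u x| ≤ (eLpNorm (fun x => g x * u x) 1 volume).toReal := by
    rw [eLpNorm_one_eq_lintegral_enorm, ← Real.norm_eq_abs, ← toReal_enorm]
    refine ENNReal.toReal_mono ?_ (enorm_integral_le_lintegral_enorm _)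
    exact hi.2.ne
  refine h2.trans ((ENNReal.toReal_mono ?_ hb).trans_eq ?_)
  · exact ENNReal.mul_ne_top hgq.2.ne (ENNReal.mul_ne_top ENNReal.coe_ne_top ENNReal.ofReal_ne_top)
  · rw [ENNReal.toReal_mul, ENNReal.toReal_mul, ENNReal.coe_toReal,
      ENNReal.toReal_ofReal (Real.sqrt_nonneg _), mul_assoc]

/-! ### The energy: lower bound and convexity -/

/-- Sobolev pairs at which the partition function `∫ g e^{V + u}` is finite. -/
structure IsAdmissible (g V u : R3 → ℝ) (G : R3 → R3) : Prop extends IsSobolevPair u G where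
  integrable : Integrable (fun x => g x * Real.exp (V x + u x)) volume

/-- The energy whose Euler–Lagrange equation is `Δ u = g e^{V + u} / ∫ g e^{V + u}`. -/
noncomputable def chargeEnergy (g V u : R3 → ℝ) (G : R3 → R3) : ℝ :=
  1 / 2 * (∫ x, ‖G x‖ ^ 2) + Real.log (∫ x, g x * Real.exp (V x + u x))

section Energy

variable {g V : R3 → ℝ} {K : R3 → R3}

theorem aestronglyMeasurable_mul_exp {u : R3 → ℝ} (hg : AEStronglyMeasurable g volume)
    (hV : AEStronglyMeasurable V volume) (hu : AEStronglyMeasurable u volume) :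
    AEStronglyMeasurable (fun x => g x * Real.exp (V x + u x)) volume :=
  hg.mul (Real.continuous_exp.comp_aestronglyMeasurable (hV.add hu))

/-- Jensen's inequality for the exponential. -/
theorem log_integral_add_le (hg : Integrable g volume)
    (hg0 : ∀ᵐ x ∂(volume : Measure R3), 0 ≤ g x) (hg_pos : 0 < ∫ x, g x) {f : R3 → ℝ}
    (hf : Integrable (fun x => g x * f x) volume)
    (hfe : Integrable (fun x => g x * Real.exp (f x)) volume) :
    Real.log (∫ x, g x) + (∫ x, g x * f x) / (∫ x, g x) ≤
      Real.log (∫ x, g x * Real.exp (f x)) := by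
  set m := ∫ x, g x
  set a := (∫ x, g x * f x) / m
  have hZ := integral_mul_exp_pos hg hg0 hg_pos hfe
  rw [Real.le_log_iff_exp_le hZ, Real.exp_add, Real.exp_log hg_pos]
  -- Tangent line of the exponential at the `g`-weighted mean `a` of `f`: `e^{f - a} ≥ 1 + f - a`,
  -- whose linear part integrates to zero against `g`.
  have h1 : ∫ x, (g x * (1 - a) + g x * f x) ≤ ∫ x, g x * Real.exp (f x) * Real.exp (-a) := by
    refine integral_mono_ae ((hg.mul_const _).add hf) (hfe.mul_const _) ?_
    filter_upwards [hg0] with x hx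
    have := Real.add_one_le_exp (f x - a)
    calc g x * (1 - a) + g x * f x = g x * (f x - a + 1) := by ring
      _ ≤ g x * Real.exp (f x - a) := by gcongr
      _ = g x * Real.exp (f x) * Real.exp (-a) := by rw [sub_eq_add_neg, Real.exp_add]; ring
  rw [integral_add (hg.mul_const _) hf, integral_mul_const, integral_mul_const] at h1
  have h2 : m * (1 - a) + ∫ x, g x * f x = m := by
    have : m * a = ∫ x, g x * f x := mul_div_cancel₀ _ hg_pos.ne'
    linarith
  rw [h2, Real.exp_neg, ← div_eq_mul_inv, le_div_iff₀ (Real.exp_pos _)] at h1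
  exact h1

/-- Jensen reduces the logarithm to `∫ g (V + u)`, which is at worst linear in `‖∇u‖₂`; the
quadratic Dirichlet term dominates it. -/
theorem exists_le_chargeEnergy (h1 : MemLp g 1 volume) (ht : MemLp g ⊤ volume)
    (hg0 : ∀ᵐ x ∂(volume : Measure R3), 0 ≤ g x) (hg_pos : 0 < ∫ x, g x)
    (hV : IsSobolevPair V K) :
    ∃ c, ∀ {u : R3 → ℝ} {G : R3 → R3}, IsAdmissible g V u G → c ≤ chargeEnergy g V u G := by
  obtain ⟨N, hN0, hN⟩ := exists_abs_integral_mul_le h1 ht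
  have hg := memLp_one_iff_integrable.1 h1
  set m := ∫ x, g x
  set b := N * √(∫ x, ‖K x‖ ^ 2)
  -- The last term is the minimum over `s` of `s² / 2 - (N / m) s`.
  refine ⟨Real.log m - b / m - (N / m) ^ 2 / 2, fun {u G} h => ?_⟩
  obtain ⟨hi1, hb1⟩ := hN hV
  obtain ⟨hi2, hb2⟩ := hN h.toIsSobolevPair
  have hi : Integrable (fun x => g x * (V x + u x)) volume := by
    simp only [mul_add]
    exact hi1.add hi2
  have hJ := log_integral_add_le hg hg0 hg_pos hi h.integrable
  simp only [mul_add] at hJ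
  rw [integral_add hi1 hi2] at hJ
  set s := √(∫ x, ‖G x‖ ^ 2)
  have hs : ∫ x, ‖G x‖ ^ 2 = s ^ 2 := (Real.sq_sqrt (integral_nonneg fun x => sq_nonneg _)).symm
  have h3 : (-b - N * s) / m ≤ ((∫ x, g x * V x) + ∫ x, g x * u x) / m := by
    gcongr
    linarith [(abs_le.1 hb1).1, (abs_le.1 hb2).1]
  have h4 : (-b - N * s) / m = - (b / m) - N / m * s := by ring
  unfold chargeEnergy
  rw [hs]
  nlinarith [sq_nonneg (s - N / m)]

/-- Shows that the admissible class is nonempty. The zero function would require `g e^V` to be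
integrable, whereas `u = -V` cancels the potential. -/
theorem isAdmissible_neg (hg : Integrable g volume) (hV : IsSobolevPair V K) :
    IsAdmissible g V (-V) (-K) :=
  ⟨hV.neg, by simpa using hg⟩

/-- The energy is uniformly convex in the gradient. -/
theorem IsAdmissible.midpoint (hg : Integrable g volume)
    (hg0 : ∀ᵐ x ∂(volume : Measure R3), 0 ≤ g x) (hg_pos : 0 < ∫ x, g x)
    (hV : IsSobolevPair V K) {u v : R3 → ℝ} {G H : R3 → R3} (hu : IsAdmissible g V u G) (hv : IsAdmissible g V v H) :
    ∃ (w : R3 → ℝ) (F : R3 → R3), IsAdmissible g V w F ∧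
      chargeEnergy g V w F + 1 / 8 * (∫ x, ‖(G - H) x‖ ^ 2) ≤
        1 / 2 * chargeEnergy g V u G + 1 / 2 * chargeEnergy g V v H := by
  have hZu := integral_mul_exp_pos hg hg0 hg_pos hu.integrable
  have hZv := integral_mul_exp_pos hg hg0 hg_pos hv.integrable
  have hui := hu.integrable
  have hvi := hv.integrable
  set Zu := ∫ x, g x * Real.exp (V x + u x)
  set Zv := ∫ x, g x * Real.exp (V x + v x)
  have hpair := (hu.toIsSobolevPair.add hv.toIsSobolevPair).const_smul (1 / 2)
  set w : R3 → ℝ := (1 / 2 : ℝ) • (u + v)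
  set F : R3 → R3 := (1 / 2 : ℝ) • (G + H)
  set c := 1 / 2 * Real.log Zu + 1 / 2 * Real.log Zv
  -- Normalising by `Zu` and `Zv` before using convexity of `exp` makes the bracket integrate to one
  -- against `g`; this gives convexity of the logarithm of the partition function, as in the proof
  -- of Hölder from Young.
  have hpt : ∀ x, Real.exp (V x + w x) ≤ Real.exp c * (1 / 2 * (Real.exp (V x + u x) / Zu) +
      1 / 2 * (Real.exp (V x + v x) / Zv)) := fun x => by
    have hcv := convexOn_exp.2 (Set.mem_univ (V x + u x - Real.log Zu))
      (Set.mem_univ (V x + v x - Real.log Zv)) (by norm_num : (0 : ℝ) ≤ 1 / 2)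
      (by norm_num : (0 : ℝ) ≤ 1 / 2) (by norm_num)
    rw [Real.exp_sub, Real.exp_sub, Real.exp_log hZu, Real.exp_log hZv] at hcv
    simp only [smul_eq_mul] at hcv
    have e : V x + w x = c + (1 / 2 * (V x + u x - Real.log Zu) +
        1 / 2 * (V x + v x - Real.log Zv)) := by
      simp only [w, c, Pi.smul_apply, Pi.add_apply, smul_eq_mul]; ring
    rw [e, Real.exp_add]
    gcongr
  have hdi : Integrable (fun x => Real.exp c * (1 / 2 * (g x * Real.exp (V x + u x) / Zu) +
      1 / 2 * (g x * Real.exp (V x + v x) / Zv))) volume :=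
    (((hui.div_const _).const_mul _).add ((hvi.div_const _).const_mul _)).const_mul _
  have hle : ∀ᵐ x ∂(volume : Measure R3), g x * Real.exp (V x + w x) ≤
      Real.exp c * (1 / 2 * (g x * Real.exp (V x + u x) / Zu) +
      1 / 2 * (g x * Real.exp (V x + v x) / Zv)) := by
    filter_upwards [hg0] with x hx
    calc _ ≤ g x * _ := mul_le_mul_of_nonneg_left (hpt x) hx
      _ = _ := by ring
  have hwm := aestronglyMeasurable_mul_exp hg.1 hV.memLp.1 hpair.memLp.1
  have hwi : Integrable (fun x => g x * Real.exp (V x + w x)) volume := by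
    refine hdi.mono' hwm ?_
    filter_upwards [hle, hg0] with x hx hx0
    rwa [Real.norm_of_nonneg (mul_nonneg hx0 (Real.exp_pos _).le)]
  have hZw := integral_mul_exp_pos hg hg0 hg_pos hwi
  have hlog : Real.log (∫ x, g x * Real.exp (V x + w x)) ≤ c := by
    rw [Real.log_le_iff_le_exp hZw]
    refine (integral_mono_ae hwi hdi hle).trans_eq ?_
    rw [integral_const_mul, integral_add ((hui.div_const _).const_mul _)
      ((hvi.div_const _).const_mul _), integral_const_mul, integral_const_mul, integral_div,
      integral_div, div_self hZu.ne', div_self hZv.ne']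
    norm_num
  refine ⟨w, F, ⟨hpair, hwi⟩, ?_⟩
  have hsq : ∀ {G : R3 → R3}, MemLp G 2 volume → Integrable (fun x => ‖G x‖ ^ 2) volume :=
    fun hG => hG.integrable_norm_pow (by norm_num)
  have hpar : (∫ x, ‖F x‖ ^ 2) + 1 / 4 * (∫ x, ‖(G - H) x‖ ^ 2) =
      1 / 2 * (∫ x, ‖G x‖ ^ 2) + 1 / 2 * ∫ x, ‖H x‖ ^ 2 := by
    have hG := hu.memLp_grad
    have hH := hv.memLp_grad
    simp only [← integral_const_mul]
    rw [← integral_add (hsq hpair.memLp_grad) ((hsq (hG.sub hH)).const_mul _),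
      ← integral_add ((hsq hG).const_mul _) ((hsq hH).const_mul _)]
    refine integral_congr_ae (.of_forall fun x => ?_)
    have := parallelogram_law_with_norm ℝ (G x) (H x)
    simp only [F, Pi.smul_apply, Pi.add_apply, Pi.sub_apply, norm_smul, mul_pow]
    norm_num
    linarith
  simp only [c, Zu, Zv] at hlog
  unfold chargeEnergy
  linarith

end Energy

/-! ### Existence of a minimiser and its Euler–Lagrange equation -/

section Minimiser

variable {g V : R3 → ℝ} {K : R3 → R3}

theorem exists_tendsto_eLpNorm_of_geometric {E : Type*} [NormedAddCommGroup E] [CompleteSpace E]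
    {p : ℝ≥0∞} (hp : 1 ≤ p) {f : ℕ → R3 → E} (hf : ∀ n, MemLp (f n) p volume) {C : ℝ≥0∞}
    (hC : C ≠ ⊤)
    (h : ∀ N n m : ℕ, N ≤ n → N ≤ m → eLpNorm (f n - f m) p volume ≤ C * (1 / 2) ^ N) :
    ∃ F, MemLp F p volume ∧ Tendsto (fun n => eLpNorm (f n - F) p volume) atTop (𝓝 0) := by
  -- Enlarging `C` to `C + 1` gives the strict inequality that the completeness criterion asks for,
  -- even when `C = 0`.
  refine Lp.cauchy_complete_eLpNorm hp hf (B := fun N => (C + 1) * (1 / 2) ^ N) ?_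
    fun N n m hn hm => (h N n m hn hm).trans_lt ?_
  · rw [ENNReal.tsum_mul_left, ENNReal.tsum_geometric]
    refine ENNReal.mul_ne_top (ENNReal.add_ne_top.2 ⟨hC, ENNReal.one_ne_top⟩) ?_
    simp
  · refine ENNReal.mul_lt_mul_left (by simp) ?_ ?_
    · simp
    · exact ENNReal.lt_add_right hC one_ne_zero

/-- The midpoint of two almost minimisers has energy at least the infimum, so uniform convexity
bounds the distance of their gradients. Strong convergence follows, and Fatou supplies lower
semicontinuity of the logarithmic term. -/
theorem exists_minimiser (h1 : MemLp g 1 volume) (ht : MemLp g ⊤ volume)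
    (hg0 : ∀ᵐ x ∂(volume : Measure R3), 0 ≤ g x) (hg_pos : 0 < ∫ x, g x)
    (hV : IsSobolevPair V K) :
    ∃ (u : R3 → ℝ) (G : R3 → R3), IsAdmissible g V u G ∧
      ∀ {v : R3 → ℝ} {H : R3 → R3}, IsAdmissible g V v H →
        chargeEnergy g V u G ≤ chargeEnergy g V v H := by
  have hg := memLp_one_iff_integrable.1 h1
  obtain ⟨c, hc⟩ := exists_le_chargeEnergy h1 ht hg0 hg_pos hV
  let S : Set ℝ := {J | ∃ (u : R3 → ℝ) (G : R3 → R3), IsAdmissible g V u G ∧ J = chargeEnergy g V u G}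
  have hSne : S.Nonempty := ⟨_, _, _, isAdmissible_neg hg hV, rfl⟩
  have hSb : BddBelow S := ⟨c, by rintro _ ⟨u, G, h, rfl⟩; exact hc h⟩
  set I := sInf S
  have hI : ∀ {v : R3 → ℝ} {H : R3 → R3}, IsAdmissible g V v H → I ≤ chargeEnergy g V v H :=
    fun h => csInf_le hSb ⟨_, _, h, rfl⟩
  -- The tolerance carries the same `1 / 8` as the convexity gap in `IsAdmissible.midpoint`, so that
  -- gradients differ by at most `2^{-N}` in `L²`.
  have hseq : ∀ n : ℕ, ∃ (u : R3 → ℝ) (G : R3 → R3), IsAdmissible g V u G ∧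
      chargeEnergy g V u G < I + 1 / 8 * ((1 / 2) ^ n) ^ 2 := fun n => by
    obtain ⟨_, ⟨u, G, h, rfl⟩, hlt⟩ := exists_lt_of_csInf_lt hSne
      (show sInf S < I + 1 / 8 * ((1 / 2) ^ n) ^ 2 from lt_add_of_pos_right _ (by positivity))
    exact ⟨u, G, h, hlt⟩
  choose U D hA hJ using hseq
  have hgrad : ∀ N n m : ℕ, N ≤ n → N ≤ m →
      eLpNorm (D n - D m) 2 volume ≤ (1 / 2) ^ N := fun N n m hn hm => by
    obtain ⟨w, F, hw, hle⟩ := (hA n).midpoint hg hg0 hg_pos hV (hA m)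
    have hmono : ∀ k, N ≤ k → ((1 / 2 : ℝ) ^ k) ^ 2 ≤ ((1 / 2) ^ N) ^ 2 := fun k hk => by
      gcongr ?_ ^ 2
      exact pow_le_pow_of_le_one (by norm_num) (by norm_num) hk
    have hint : ∫ x, ‖(D n - D m) x‖ ^ 2 ≤ ((1 / 2) ^ N) ^ 2 := by
      linarith [hI hw, hJ n, hJ m, hmono n hn, hmono m hm]
    rw [eLpNorm_two_eq ((hA n).memLp_grad.sub (hA m).memLp_grad)]
    have : (1 / 2 : ℝ≥0∞) ^ N = ENNReal.ofReal ((1 / 2) ^ N) := by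
      rw [ENNReal.ofReal_pow (by norm_num), ENNReal.ofReal_div_of_pos (by norm_num)]
      norm_num
    rw [this]
    exact ENNReal.ofReal_le_ofReal ((Real.sqrt_le_left (by positivity)).2 hint)
  obtain ⟨C, hC⟩ := IsSobolevPair.exists_eLpNorm_le
  obtain ⟨G, hG, hGlim⟩ := exists_tendsto_eLpNorm_of_geometric (p := 2) (by norm_num)
    (fun n => (hA n).memLp_grad) ENNReal.one_ne_top (by simpa using hgrad)
  obtain ⟨u, hu, hulim⟩ := exists_tendsto_eLpNorm_of_geometric (p := 6) (by norm_num)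
    (fun n => (hA n).memLp) (C := C) ENNReal.coe_ne_top fun N n m hn hm =>
      (hC ((hA n).toIsSobolevPair.sub (hA m).toIsSobolevPair)).trans (by
        gcongr
        exact hgrad N n m hn hm)
  have hpair := IsSobolevPair.of_tendsto (fun n => (hA n).toIsSobolevPair) hu hG hulim hGlim
  have hJlim : Tendsto (fun n => chargeEnergy g V (U n) (D n)) atTop (𝓝 I) := by
    have h0 : Tendsto (fun n : ℕ => I + 1 / 8 * ((1 / 2 : ℝ) ^ n) ^ 2) atTop (𝓝 I) := by
      have := ((tendsto_pow_atTop_nhds_zero_of_lt_one (r := (1 / 2 : ℝ)) (by norm_num)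
        (by norm_num)).pow 2).const_mul (1 / 8) |>.const_add I
      simpa using this
    exact tendsto_of_tendsto_of_tendsto_of_le_of_le tendsto_const_nhds h0
      (fun n => hI (hA n)) fun n => (hJ n).le
  have hZpos : ∀ n, 0 < ∫ x, g x * Real.exp (V x + U n x) := fun n =>
    integral_mul_exp_pos hg hg0 hg_pos (hA n).integrable
  -- Energies and Dirichlet integrals both converge, so the partition functions must converge, and
  -- this is their limit.
  set L := Real.exp (I - 1 / 2 * ∫ x, ‖G x‖ ^ 2)
  have hZlim : Tendsto (fun n => ∫ x, g x * Real.exp (V x + U n x)) atTop (𝓝 L) := by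
    have := (Real.continuous_exp.tendsto _).comp (hJlim.sub
      ((tendsto_integral_norm_sq (fun n => (hA n).memLp_grad) hG hGlim).const_mul (1 / 2)))
    refine this.congr fun n => ?_
    simp only [Function.comp_apply, chargeEnergy]
    rw [add_sub_cancel_left, Real.exp_log (hZpos n)]
  obtain ⟨ns, hns, hae⟩ := (tendstoInMeasure_of_tendsto_eLpNorm (by norm_num)
    (fun n => (hA n).memLp.1) hu.1 hulim).exists_seq_tendsto_ae
  have hm := aestronglyMeasurable_mul_exp hg.1 hV.memLp.1 hu.1
  have hnn : ∀ v : R3 → ℝ, 0 ≤ᵐ[volume] fun x => g x * Real.exp (V x + v x) := fun v =>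
    hg0.mono fun x hx => mul_nonneg hx (Real.exp_pos _).le
  -- This bound serves twice: its finiteness makes the limit admissible, and the value `L` gives
  -- energy at most `I`.
  have hfatou : ∫⁻ x, ENNReal.ofReal (g x * Real.exp (V x + u x)) ≤ ENNReal.ofReal L := by
    calc _ = ∫⁻ x, liminf (fun n => ENNReal.ofReal (g x * Real.exp (V x + U (ns n) x))) atTop := by
          refine lintegral_congr_ae ?_
          filter_upwards [hae] with x hx
          refine (Tendsto.liminf_eq ?_).symm
          refine ENNReal.tendsto_ofReal (Tendsto.const_mul _ ?_)
          exact (Real.continuous_exp.tendsto _).comp (hx.const_add _)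
      _ ≤ liminf (fun n => ∫⁻ x, ENNReal.ofReal (g x * Real.exp (V x + U (ns n) x))) atTop :=
          lintegral_liminf_le' fun n => (hA (ns n)).integrable.1.aemeasurable.ennreal_ofReal
      _ = ENNReal.ofReal L := by
          refine Tendsto.liminf_eq ?_
          simp_rw [fun n => (ofReal_integral_eq_lintegral_ofReal (hA (ns n)).integrable
            (hnn _)).symm]
          exact (ENNReal.tendsto_ofReal hZlim).comp hns.tendsto_atTop
  have hi : Integrable (fun x => g x * Real.exp (V x + u x)) volume :=
    ⟨hm, (hasFiniteIntegral_iff_ofReal (hnn u)).2 (hfatou.trans_lt ENNReal.ofReal_lt_top)⟩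
  have hadm : IsAdmissible g V u G := ⟨hpair, hi⟩
  refine ⟨u, G, hadm, fun {v H} hv => le_trans ?_ (hI hv)⟩
  have hZle : ∫ x, g x * Real.exp (V x + u x) ≤ L := by
    rw [← ofReal_integral_eq_lintegral_ofReal hi (hnn u)] at hfatou
    exact (ENNReal.ofReal_le_ofReal_iff (Real.exp_pos _).le).1 hfatou
  have := (Real.log_le_iff_le_exp (integral_mul_exp_pos hg hg0 hg_pos hi)).2 hZle
  unfold chargeEnergy
  linarith

/-- The Euler–Lagrange equation of the charge energy. -/
theorem IsAdmissible.euler_lagrange (hg : Integrable g volume)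
    (hg0 : ∀ᵐ x ∂(volume : Measure R3), 0 ≤ g x) (hg_pos : 0 < ∫ x, g x)
    {u : R3 → ℝ} {G : R3 → R3} (h : IsAdmissible g V u G)
    (hmin : ∀ {v : R3 → ℝ} {H : R3 → R3}, IsAdmissible g V v H →
        chargeEnergy g V u G ≤ chargeEnergy g V v H)
    {χ : R3 → ℝ} (hχ : ContDiff ℝ ∞ χ) (hs : HasCompactSupport χ) :
    - ∫ x, inner ℝ (gradient χ x) (G x) =
      ∫ x, χ x * (g x * Real.exp (V x + u x) / ∫ y, g y * Real.exp (V y + u y)) := by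
  have hp := IsSobolevPair.of_test hχ hs
  have hui := h.integrable
  obtain ⟨M, hM⟩ := hs.exists_bound_of_continuous hχ.continuous
  have hM0 : 0 ≤ M := (norm_nonneg _).trans (hM 0)
  -- The perturbation only multiplies the density by `e^{tχ}`, bounded because `χ` is; hence every
  -- `t` is admissible and the integral can be differentiated under the sign.
  have hfac : ∀ (t : ℝ) x, g x * Real.exp (V x + (u + t • χ) x) =
      Real.exp (t * χ x) * (g x * Real.exp (V x + u x)) := fun t x => by
    simp only [Pi.add_apply, Pi.smul_apply, smul_eq_mul]
    rw [← add_assoc, Real.exp_add]; ring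
  have hexp : ∀ (t : ℝ) x, ‖Real.exp (t * χ x)‖ ≤ Real.exp (|t| * M) := fun t x => by
    rw [Real.norm_of_nonneg (Real.exp_pos _).le, Real.exp_le_exp]
    calc t * χ x ≤ |t * χ x| := le_abs_self _
      _ = |t| * ‖χ x‖ := by rw [abs_mul, Real.norm_eq_abs]
      _ ≤ |t| * M := by gcongr; exact hM x
  have hexpc : ∀ t : ℝ, Continuous fun x => Real.exp (t * χ x) := fun t =>
    Real.continuous_exp.comp (continuous_const.mul hχ.continuous)
  have hadm : ∀ t : ℝ, IsAdmissible g V (u + t • χ) (G + t • gradient χ) := fun t =>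
    ⟨h.toIsSobolevPair.add (hp.const_smul t), by
      simp_rw [hfac]
      exact hui.bdd_mul (hexpc t).aestronglyMeasurable (.of_forall (hexp t))⟩
  have hZ := integral_mul_exp_pos hg hg0 hg_pos hui
  have hdZ : HasDerivAt (fun t : ℝ => ∫ x, g x * Real.exp (V x + (u + t • χ) x))
      (∫ x, χ x * (g x * Real.exp (V x + u x))) 0 := by
    have := (hasDerivAt_integral_of_dominated_loc_of_deriv_le (μ := (volume : Measure R3))
      (F := fun (t : ℝ) x => Real.exp (t * χ x) * (g x * Real.exp (V x + u x)))
      (F' := fun (t : ℝ) x => Real.exp (t * χ x) * χ x * (g x * Real.exp (V x + u x)))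
      (bound := fun x => Real.exp M * M * ‖g x * Real.exp (V x + u x)‖)
      (x₀ := (0 : ℝ)) (s := Metric.ball 0 1) (Metric.ball_mem_nhds _ one_pos)
      (.of_forall fun t => (hexpc t).aestronglyMeasurable.mul hui.1)
      (hui.bdd_mul (hexpc 0).aestronglyMeasurable (.of_forall (hexp 0)))
      (((hexpc 0).mul hχ.continuous).aestronglyMeasurable.mul hui.1)
      (.of_forall fun x t ht => by
        rw [norm_mul, norm_mul]
        have ht1 : |t| ≤ 1 := by simpa using (mem_ball_zero_iff.1 ht).le
        gcongr
        · refine (hexp t x).trans (Real.exp_le_exp.2 ?_)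
          nlinarith
        · exact hM x)
      (hui.norm.const_mul _)
      (.of_forall fun x t _ => by
        have := ((hasDerivAt_id t).mul_const (χ x)).exp
        simp only [id, one_mul] at this
        exact this.mul_const _)).2
    simp_rw [hfac]
    simpa using this
  have hdG : HasDerivAt (fun t : ℝ => ∫ x, ‖(G + t • gradient χ) x‖ ^ 2)
      (2 * ∫ x, inner ℝ (gradient χ x) (G x)) 0 := by
    have hi1 : Integrable (fun x => ‖G x‖ ^ 2) volume :=
      h.memLp_grad.integrable_norm_pow (by norm_num)
    have hi2 := integrable_inner_of_memLp hp.memLp_grad h.memLp_grad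
    have hi3 : Integrable (fun x => ‖gradient χ x‖ ^ 2) volume :=
      hp.memLp_grad.integrable_norm_pow (by norm_num)
    -- The Dirichlet integral is an explicit quadratic polynomial in `t`.
    have e : ∀ t : ℝ, ∫ x, ‖(G + t • gradient χ) x‖ ^ 2 = (∫ x, ‖G x‖ ^ 2) +
        t * (2 * ∫ x, inner ℝ (gradient χ x) (G x)) + t ^ 2 * ∫ x, ‖gradient χ x‖ ^ 2 := by
      intro t
      rw [← integral_const_mul, ← integral_const_mul, ← integral_const_mul,
        ← integral_add hi1 ((hi2.const_mul 2).const_mul t),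
        ← integral_add (f := fun x => ‖G x‖ ^ 2 + t * (2 * inner ℝ (gradient χ x) (G x)))
          (hi1.add ((hi2.const_mul 2).const_mul t)) (hi3.const_mul _)]
      refine integral_congr_ae (.of_forall fun x => ?_)
      simp only [Pi.add_apply, Pi.smul_apply]
      rw [norm_add_sq_real, real_inner_smul_right, norm_smul, mul_pow, real_inner_comm,
        Real.norm_eq_abs, sq_abs]
      ring
    simp_rw [e]
    have hd := (((hasDerivAt_id (0 : ℝ)).mul_const (2 * ∫ x, inner ℝ (gradient χ x) (G x))).const_add
      (∫ x, ‖G x‖ ^ 2)).add (((hasDerivAt_id (0 : ℝ)).pow 2).mul_const (∫ x, ‖gradient χ x‖ ^ 2))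
    exact hd.congr_deriv (by simp)
  have hZ0 : (∫ x, g x * Real.exp (V x + (u + (0 : ℝ) • χ) x)) =
      ∫ x, g x * Real.exp (V x + u x) := by simp
  have hdJ := (hdG.const_mul (1 / 2)).add (hdZ.log (by rw [hZ0]; exact hZ.ne'))
  have hloc : IsLocalMin (fun t : ℝ => chargeEnergy g V (u + t • χ) (G + t • gradient χ)) 0 :=
    .of_forall fun t => by simpa using hmin (hadm t)
  have key := hloc.hasDerivAt_eq_zero hdJ
  rw [hZ0] at key
  simp_rw [← mul_div_assoc]
  rw [integral_div]
  linarith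

end Minimiser

/-! ### Existence and uniqueness -/

theorem lemma2p5 (g : R3 → ℝ)
    (hg_one : MemLp g 1 volume) (hg_top : MemLp g ∞ volume)
    (hg_nonneg : ∀ᵐ x ∂(volume : Measure R3), 0 ≤ g x)
    (hg_pos : 0 < ∫ x, g x)
    (Ubar : R3 → ℝ) (hUbar : MemHomogeneousSobolev Ubar)
    (hUbar_nonneg : ∀ᵐ x ∂(volume : Measure R3), 0 ≤ Ubar x) :
    ∃ Uhat : R3 → ℝ,
      IsFixedChargeSolution g Ubar Uhat ∧
      0 < ∫⁻ x, ENNReal.ofReal (g x * Real.exp (Ubar x + Uhat x)) ∧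
      ∫⁻ x, ENNReal.ofReal (g x * Real.exp (Ubar x + Uhat x)) < ⊤ ∧
      ∀ W : R3 → ℝ, IsFixedChargeSolution g Ubar W →
        ∀ᵐ x ∂(volume : Measure R3), W x = Uhat x := by
  obtain ⟨K, hV⟩ := hUbar.exists_pair
  have hg := memLp_one_iff_integrable.1 hg_one
  obtain ⟨u, G, hu, hmin⟩ := exists_minimiser hg_one hg_top hg_nonneg hg_pos hV
  have hi := hu.integrable
  have hsol : IsFixedChargeSolution g Ubar u :=
    ⟨hu.memHomogeneousSobolev, hi, (hi.div_const _).locallyIntegrable, G, hu.hasWeakGradient,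
      fun χ hχ hs => hu.euler_lagrange hg hg_nonneg hg_pos hmin hχ hs⟩
  have hlint := ofReal_integral_eq_lintegral_ofReal hi
    (hg_nonneg.mono fun x hx => mul_nonneg hx (Real.exp_pos _).le)
  refine ⟨u, hsol, ?_, ?_, fun W hW => hsol.ae_unique hg hg_nonneg hg_pos hW⟩
  · rw [← hlint, ENNReal.ofReal_pos]
    exact integral_mul_exp_pos hg hg_nonneg hg_pos hi
  · rw [← hlint]
    exact ENNReal.ofReal_lt_top
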